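/- Let $q=e^{2\pi i\tau}$ with $\operatorname{Im}\tau>0$, and write $q^{s}=e^{2\pi i\tau s}$ for $s\in\mathbb{C}$. Put $$(x;q)_n=\prod_{r=0}^{n-1}(1-xq^r)\quad(n\in\mathbb{N}\cup\{\infty\}),\qquad (x,y,\dots;q)_\infty=(x;q)_\infty(y;q)_\infty\cdots,$$ $$J_m=(q^m;q^m)_\infty,\qquad \overline{J}_{b,m}=(-q^{b},-q^{m-b},q^m;q^m)_\infty .$$ Then, for all $a,c\in\mathbb{C}$, the following six triple sums converge absolutely and satisfy $$\sum_{i,j,k\ge 0}\frac{q^{2i^2+2j^2+2k^2-2ik-2jk-2j+ak}}{(q^4;q^4)_i(q^4;q^4)_j(q^4;q^4)_k}=(-1,-q^a;q^2)_\infty,$$ $$\sum_{i,j,k\ge 0}\frac{q^{2i^2+2j^2+2k^2-2ik-2jk+i-j+2k}}{(q^4;q^4)_i(q^4;q^4)_j(q^4;q^4)_k}=\frac{J_2^2J_6^2}{J_1J_3J_4^2},$$ $$\sum_{i,j,k\ge 0}\frac{q^{2i^2+2j^2+2k^2-2ik-2jk-ci+cj}}{(q^4;q^4)_i(q^4;q^4)_j(q^4;q^4)_k}=\frac{\overline{J}_{2+c,4}\,\overline{J}_{6+c,12}}{J_4^2}+q^2\,\frac{\overline{J}_{-c,4}\,\overline{J}_{c,12}}{J_4^2},$$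 $$\sum_{i,j,k\ge 0}\frac{q^{i^2+j^2+k^2-ik-jk-k}}{(q^2;q^2)_i(q^2;q^2)_j(q^2;q^2)_k}=6\,\frac{J_3^3}{J_1J_2^2},$$ $$\sum_{i,j,k\ge 0}\frac{q^{i^2+j^2+k^2-ik-jk+i+j-k}}{(q^2;q^2)_i(q^2;q^2)_j(q^2;q^2)_k}=2\,\frac{J_3^3}{J_1J_2^2},$$ $$\sum_{i,j,k\ge 0}\frac{q^{i^2+j^2+k^2-ik-jk+i+j}}{(q^2;q^2)_i(q^2;q^2)_j(q^2;q^2)_k}=\frac{J_3^3}{J_1J_2^2}.$$ -/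

import Mathlib

open Finset

noncomputable section

/-- The power `q ^ s`, where `q = exp (2 π i τ)` with `Im τ > 0`, and `s` is any complex exponent. -/
def qpow (τ : UpperHalfPlane) (s : ℂ) : ℂ :=
  Complex.exp (2 * (Real.pi : ℂ) * Complex.I * (τ : ℂ) * s)

/-- The finite `q`-shifted factorial `(a; q)_n = ∏_{k < n} (1 - a q ^ k)`. -/
def qPoch (a q : ℂ) (n : ℕ) : ℂ := ∏ k ∈ range n, (1 - a * q ^ k)

/-- The infinite product `(a; q)_∞ = ∏_{k ≥ 0} (1 - a q ^ k)`; it is only used for `|q| < 1`,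
where it converges absolutely. -/
def qPochInf (a q : ℂ) : ℂ := ∏' k : ℕ, (1 - a * q ^ k)

/-- `J_m = (q ^ m; q ^ m)_∞` with `q = exp (2 π i τ)`. -/
def qJ (τ : UpperHalfPlane) (m : ℕ) : ℂ := qPochInf (qpow τ m) (qpow τ m)

/-- `\bar J_{a,m} = (-q ^ a, -q ^ (m - a), q ^ m; q ^ m)_∞` with `q = exp (2 π i τ)`. -/
def qJbar (τ : UpperHalfPlane) (a : ℂ) (m : ℕ) : ℂ :=
  qPochInf (-qpow τ a) (qpow τ m) * qPochInf (-qpow τ (m - a)) (qpow τ m)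
    * qPochInf (qpow τ m) (qpow τ m)

/-- The general term, at `n = (i, j, k)`, of a triple sum: `q ^ e(i, j, k)` divided by
`(q ^ m; q ^ m)_i (q ^ m; q ^ m)_j (q ^ m; q ^ m)_k`, with `q = exp (2 π i τ)`. -/
def nahmTerm (τ : UpperHalfPlane) (m : ℕ) (e : ℂ → ℂ → ℂ → ℂ) (n : ℕ × ℕ × ℕ) : ℂ :=
  qpow τ (e n.1 n.2.1 n.2.2) /
    (qPoch (qpow τ m) (qpow τ m) n.1 * qPoch (qpow τ m) (qpow τ m) n.2.1
      * qPoch (qpow τ m) (qpow τ m) n.2.2)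

end

/-! ### Infinite `q`-products -/

/-! Write `nome h s` for q^s, and let S(a,b,c) = `ternSum h a b c` be the sum with exponent
i²+j²+k²-ik-jk+ai+bj+ck over (q²;q²)_i (q²;q²)_j (q²;q²)_k; replacing h by 2h gives base q⁴. Two
tools are basic: Euler's expansion of (-q^(s+1);q²)_∞, and the Durfee rectangle identity, by which a
double sum grouped by a - b = d has each inner sum equal to 1/(q²;q²)_∞. Together they give Jacobi's
triple product.

In the first family the sums over i and j at fixed k are Euler sums; their product partly cancels
(q²;q²)_k, and the sum over k is Euler's again, in base q.

The other five rest on S(-s,s,0) = (q²;q²)_∞^(-2) ∑ q^(N²-Nd+d²+sN), where N = j - i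
(`ternSum_neg_self`). At fixed N and k, the sum over i is converted by a recurrence in k
(`qInv_mul_diagSum`) into a convolution. Summed over k, the convolution is a product of two Euler
sums, which Durfee rectangles turn into a theta series in d. Splitting by the parity of d
diagonalises the form to a²+3b² and gives the third identity.

For the remaining sums, `ternSum_sub_fst`, `ternSum_sub_snd` and `ternSum_sub_thd` relate
neighbouring parameters. The second identity then reduces to the hexagonal series at s = 3/2 and
Gauss's product for ∑ q^(n²+n/2). The last three need the Borwein evaluation ∑ q^(N²-Nd+d²+N) =
3J_3³/J_1 (`hexSum_one_mul`) and one value off the line (-s,s,0): S(1,1,-1). It comes from the first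
moment of i - j, which vanishes by symmetry when a = b, and which on the hexagonal side is fixed by
the centre -2/3 of a threefold rotation. With unit J_3³/(J_1J_2²), S(-1,1,0) = 3 and S(1,1,-1) = 2,
so S(1,1,0) = 1; further relations give S(0,0,-1) = 6. -/

lemma summable_norm_qPoch {q : ℂ} (hq : ‖q‖ < 1) (a : ℂ) : Summable fun k : ℕ => ‖-(a * q ^ k)‖ := by
  simp only [norm_neg, norm_mul, norm_pow]
  exact (summable_geometric_of_lt_one (norm_nonneg q) hq).mul_left _

lemma multipliable_qPoch {q : ℂ} (hq : ‖q‖ < 1) (a : ℂ) :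
    Multipliable fun k : ℕ => (1 - a * q ^ k) := by
  simpa only [sub_eq_add_neg] using multipliable_one_add_of_summable (summable_norm_qPoch hq a)

lemma tendsto_qPoch {q : ℂ} (hq : ‖q‖ < 1) (a : ℂ) :
    Filter.Tendsto (qPoch a q) Filter.atTop (nhds (qPochInf a q)) :=
  (multipliable_qPoch hq a).hasProd.tendsto_prod_nat

lemma qPochInf_ne_zero {q : ℂ} (hq : ‖q‖ < 1) {a : ℂ} (h : ∀ k : ℕ, 1 - a * q ^ k ≠ 0) :
    qPochInf a q ≠ 0 := by
  have := tprod_one_add_ne_zero_of_summable (f := fun k : ℕ => -(a * q ^ k))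
    (fun k => by simpa only [← sub_eq_add_neg] using h k) (summable_norm_qPoch hq a)
  simpa only [qPochInf, sub_eq_add_neg] using this

lemma qPochInf_eq_one_sub_mul {q : ℂ} (hq : ‖q‖ < 1) (a : ℂ) :
    qPochInf a q = (1 - a) * qPochInf (a * q) q := by
  unfold qPochInf
  rw [tprod_eq_zero_mul']
  · simp [pow_succ', mul_assoc]
  · simpa only [pow_succ', mul_assoc] using multipliable_qPoch hq (a * q)

lemma norm_sq_lt_one {q : ℂ} (hq : ‖q‖ < 1) : ‖q ^ 2‖ < 1 := by
  rw [norm_pow]; exact pow_lt_one₀ (norm_nonneg q) hq two_ne_zero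

lemma norm_cube_lt_one {q : ℂ} (hq : ‖q‖ < 1) : ‖q ^ 3‖ < 1 := by
  rw [norm_pow]; exact pow_lt_one₀ (norm_nonneg q) hq three_ne_zero

lemma qPochInf_even_mul_odd {q : ℂ} (hq : ‖q‖ < 1) (a : ℂ) :
    qPochInf a (q ^ 2) * qPochInf (a * q) (q ^ 2) = qPochInf a q := by
  refine (HasProd.even_mul_odd (f := fun k : ℕ => 1 - a * q ^ k) ?_ ?_).tprod_eq.symm
  · exact (multipliable_qPoch (norm_sq_lt_one hq) a).hasProd.congr_fun fun k => by ring
  · exact (multipliable_qPoch (norm_sq_lt_one hq) (a * q)).hasProd.congr_fun fun k => by ring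

lemma qPochInf_mul_neg {q : ℂ} (hq : ‖q‖ < 1) (a : ℂ) :
    qPochInf a q * qPochInf (-a) q = qPochInf (a ^ 2) (q ^ 2) := by
  unfold qPochInf
  rw [← (multipliable_qPoch hq a).tprod_mul (multipliable_qPoch hq (-a))]
  exact tprod_congr fun k => by ring

lemma qPochInf_mul_cubic {q w : ℂ} (hq : ‖q‖ < 1) (hw : 1 + w + w ^ 2 = 0) (a : ℂ) :
    qPochInf a q * (qPochInf (w * a) q * qPochInf (w ^ 2 * a) q) = qPochInf (a ^ 3) (q ^ 3) := by
  unfold qPochInf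
  rw [← (multipliable_qPoch hq (w * a)).tprod_mul (multipliable_qPoch hq (w ^ 2 * a)),
    ← (multipliable_qPoch hq a).tprod_mul
      ((multipliable_qPoch hq (w * a)).mul (multipliable_qPoch hq (w ^ 2 * a)))]
  refine tprod_congr fun k => ?_
  have h3 : w ^ 3 = 1 := by linear_combination (w - 1) * hw
  linear_combination (-(a * q ^ k) + w * (a * q ^ k) ^ 2) * hw + ((a * q ^ k) ^ 2 - (a * q ^ k) ^ 3 - (a * q ^ k) ^ 2) * h3

/-! ### Reciprocals of finite `q`-products, extended by zero -/

/-- `1 / (Q; Q)_n` for `n ≥ 0`, and `0` for `n < 0`. -/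
noncomputable def qInv (Q : ℂ) (n : ℤ) : ℂ := if 0 ≤ n then (qPoch Q Q n.toNat)⁻¹ else 0

lemma qInv_natCast (Q : ℂ) (n : ℕ) : qInv Q n = (qPoch Q Q n)⁻¹ := by simp [qInv]

lemma qInv_of_neg (Q : ℂ) {n : ℤ} (hn : n < 0) : qInv Q n = 0 := by simp [qInv, hn]

@[simp] lemma qInv_zero (Q : ℂ) : qInv Q 0 = 1 := by simp [qInv, qPoch]

lemma one_sub_pow_ne_zero {Q : ℂ} (hQ : ‖Q‖ < 1) (k : ℕ) : 1 - Q * Q ^ k ≠ 0 := by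
  intro h
  have h1 : ‖Q ^ (k + 1)‖ < 1 := by
    rw [norm_pow]; exact pow_lt_one₀ (norm_nonneg Q) hQ (Nat.succ_ne_zero k)
  rw [pow_succ', ← sub_eq_zero.mp h] at h1
  simp at h1

lemma qPoch_ne_zero {Q : ℂ} (hQ : ‖Q‖ < 1) (n : ℕ) : qPoch Q Q n ≠ 0 :=
  Finset.prod_ne_zero_iff.mpr fun k _ => one_sub_pow_ne_zero hQ k

lemma qPochInf_self_ne_zero {Q : ℂ} (hQ : ‖Q‖ < 1) : qPochInf Q Q ≠ 0 :=
  qPochInf_ne_zero hQ (one_sub_pow_ne_zero hQ)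

/-- Extension by zero makes this recurrence hold at every integer: at n = 0 both sides vanish. Sums
over ℤ can therefore be shifted without boundary terms. -/
lemma one_sub_mul_qInv {Q : ℂ} (hQ : ‖Q‖ < 1) (n : ℤ) :
    (1 - Q ^ n) * qInv Q n = qInv Q (n - 1) := by
  rcases lt_trichotomy n 0 with hn | rfl | hn
  · rw [qInv_of_neg Q hn, qInv_of_neg Q (by lia), mul_zero]
  · rw [qInv_of_neg Q (show (0 : ℤ) - 1 < 0 by lia)]; simp
  · obtain ⟨m, rfl⟩ : ∃ m : ℕ, n = m + 1 := ⟨(n - 1).toNat, by lia⟩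
    have h1 : ((m : ℤ) + 1) = ((m + 1 : ℕ) : ℤ) := by push_cast; ring
    rw [add_sub_cancel_right, h1, qInv_natCast, qInv_natCast, zpow_natCast]
    have h2 : qPoch Q Q (m + 1) = qPoch Q Q m * (1 - Q * Q ^ m) := by
      simp [qPoch, Finset.prod_range_succ]
    have := one_sub_pow_ne_zero hQ m
    have := qPoch_ne_zero hQ m
    rw [h2, pow_succ']
    field_simp

lemma tendsto_qInv {Q : ℂ} (hQ : ‖Q‖ < 1) :
    Filter.Tendsto (fun n : ℕ => qInv Q n) Filter.atTop (nhds (qPochInf Q Q)⁻¹) := by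
  simp only [qInv_natCast]
  exact (tendsto_qPoch hQ Q).inv₀ (qPochInf_self_ne_zero hQ)

lemma exists_norm_qInv_le {Q : ℂ} (hQ : ‖Q‖ < 1) : ∃ C : ℝ, 0 ≤ C ∧ ∀ n : ℤ, ‖qInv Q n‖ ≤ C := by
  obtain ⟨C, hC⟩ := (Metric.isBounded_range_of_tendsto _ (tendsto_qInv hQ)).exists_norm_le
  refine ⟨C, (norm_nonneg _).trans (hC _ ⟨0, rfl⟩), fun n => ?_⟩
  rcases lt_or_ge n 0 with hn | hn
  · rw [qInv_of_neg Q hn, norm_zero]; exact (norm_nonneg _).trans (hC _ ⟨0, rfl⟩)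
  · exact hC _ ⟨n.toNat, by simp [Int.toNat_of_nonneg hn]⟩

/-! ### Powers of the nome -/

/-- The power `q ^ s` of the nome `q = exp h`. -/
noncomputable def nome (h s : ℂ) : ℂ := Complex.exp (h * s)

lemma nome_add (h s t : ℂ) : nome h (s + t) = nome h s * nome h t := by
  simp only [nome, mul_add, Complex.exp_add]

@[simp] lemma nome_zero (h : ℂ) : nome h 0 = 1 := by simp [nome]

lemma nome_pow (h s : ℂ) (n : ℕ) : nome h s ^ n = nome h (n * s) := by
  rw [nome, nome, ← Complex.exp_nat_mul]; ring_nf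

lemma nome_zpow (h s : ℂ) (n : ℤ) : nome h s ^ n = nome h (n * s) := by
  rw [nome, nome, ← Complex.exp_int_mul]; ring_nf

lemma nome_mul (m h s : ℂ) : nome (m * h) s = nome h (m * s) := by
  rw [nome, nome]; ring_nf

lemma norm_nome (h s : ℂ) : ‖nome h s‖ = Real.exp (h * s).re := Complex.norm_exp _

lemma norm_nome_lt_one {h : ℂ} (hh : h.re < 0) {x : ℝ} (hx : 0 < x) : ‖nome h x‖ < 1 := by
  rw [norm_nome, Real.exp_lt_one_iff]
  simpa using mul_neg_of_neg_of_pos hh hx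

lemma norm_nome_one_lt {h : ℂ} (hh : h.re < 0) : ‖nome h 1‖ < 1 := by
  simpa using norm_nome_lt_one hh one_pos

lemma norm_nome_two_lt {h : ℂ} (hh : h.re < 0) : ‖nome h 2‖ < 1 := by
  simpa using norm_nome_lt_one hh two_pos

/-! ### Summability of Gaussian sums -/

/-- The polynomial weight serves the first moments of i - j and of N used later. -/
lemma summable_gauss {T : ℝ} (hT : 0 < T) (S : ℝ) (k : ℕ) :
    Summable fun n : ℤ => |(n : ℝ)| ^ k * Real.exp (-T * n ^ 2 + S * n) := by
  have h := summable_pow_mul_jacobiTheta₂_term_bound (|S| / (2 * Real.pi))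
    (T := T / Real.pi) (by positivity) k
  refine Summable.of_nonneg_of_le (fun n => by positivity) (fun n => ?_) h
  push_cast
  gcongr
  have hpi := Real.pi_pos
  have : -Real.pi * (T / Real.pi * (n : ℝ) ^ 2 - 2 * (|S| / (2 * Real.pi)) * |(n : ℝ)|)
      = -T * (n : ℝ) ^ 2 + |S| * |(n : ℝ)| := by field_simp; ring
  rw [this, ← abs_mul]
  gcongr
  exact le_abs_self _

lemma summable_gauss_two {T : ℝ} (hT : 0 < T) (S S' : ℝ) (k l : ℕ) :
    Summable fun n : ℤ × ℤ => |(n.1 : ℝ)| ^ k * |(n.2 : ℝ)| ^ l *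
      Real.exp (-T * (n.1 ^ 2 + n.2 ^ 2) + S * n.1 + S' * n.2) := by
  refine ((summable_gauss hT S k).mul_of_nonneg (summable_gauss hT S' l)
    (fun n => by positivity) (fun n => by positivity)).congr fun n => ?_
  rw [mul_mul_mul_comm, ← Real.exp_add]
  ring_nf

lemma summable_gauss_three {T : ℝ} (hT : 0 < T) (S S' S'' : ℝ) (k l : ℕ) :
    Summable fun n : ℤ × ℤ × ℤ => |(n.1 : ℝ)| ^ k * |(n.2.1 : ℝ)| ^ l *
      Real.exp (-T * (n.1 ^ 2 + n.2.1 ^ 2 + n.2.2 ^ 2) + S * n.1 + S' * n.2.1 + S'' * n.2.2) := by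
  refine ((summable_gauss hT S k).mul_of_nonneg (summable_gauss_two hT S' S'' l 0)
    (fun n => by positivity) (fun n => by positivity)).congr fun n => ?_
  rw [pow_zero, mul_one, mul_mul_mul_comm, ← Real.exp_add]
  ring_nf

lemma summable_nome_sq {h : ℂ} (hh : h.re < 0) (s : ℂ) (k : ℕ) :
    Summable fun n : ℤ => |(n : ℝ)| ^ k * ‖nome h (n ^ 2 + s * n)‖ := by
  refine (summable_gauss (neg_pos.mpr hh) (h * s).re k).congr fun n => ?_
  rw [norm_nome]
  congr 2
  have : h * ((n : ℂ) ^ 2 + s * n) = ((n ^ 2 : ℝ) : ℂ) * h + ((n : ℝ) : ℂ) * (h * s) := by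
    push_cast; ring
  rw [this, Complex.add_re, Complex.re_ofReal_mul, Complex.re_ofReal_mul]
  ring

lemma summable_nome_hex {h : ℂ} (hh : h.re < 0) (s t : ℂ) (k l : ℕ) :
    Summable fun n : ℤ × ℤ => |(n.1 : ℝ)| ^ k * |(n.2 : ℝ)| ^ l *
      ‖nome h (n.1 ^ 2 - n.1 * n.2 + n.2 ^ 2 + s * n.1 + t * n.2)‖ := by
  refine Summable.of_nonneg_of_le (fun n => by positivity) (fun n => ?_)
    (summable_gauss_two (T := -h.re / 4) (by linarith) (h * s).re (h * t).re k l)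
  rw [norm_nome]
  gcongr
  have : h * ((n.1 : ℂ) ^ 2 - n.1 * n.2 + n.2 ^ 2 + s * n.1 + t * n.2) =
      ((n.1 ^ 2 - n.1 * n.2 + n.2 ^ 2 : ℝ) : ℂ) * h + ((n.1 : ℝ) : ℂ) * (h * s)
        + ((n.2 : ℝ) : ℂ) * (h * t) := by
    push_cast; ring
  rw [this, Complex.add_re, Complex.add_re, Complex.re_ofReal_mul, Complex.re_ofReal_mul,
    Complex.re_ofReal_mul]
  nlinarith [mul_nonneg (neg_nonneg.mpr hh.le) (sq_nonneg ((n.1 : ℝ) - n.2)),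
    mul_nonneg (neg_nonneg.mpr hh.le) (sq_nonneg (n.1 : ℝ)),
    mul_nonneg (neg_nonneg.mpr hh.le) (sq_nonneg (n.2 : ℝ))]

/-- The ternary form has least eigenvalue 1 - 1/√2 > 1/4, hence the rate -Re h / 4; the squares of
3i - 2k and 3j - 2k certify the bound. -/
lemma summable_nome_ternary {h : ℂ} (hh : h.re < 0) (a b c : ℂ) (k l : ℕ) :
    Summable fun n : ℤ × ℤ × ℤ => |(n.1 : ℝ)| ^ k * |(n.2.1 : ℝ)| ^ l *
      ‖nome h (n.1 ^ 2 + n.2.1 ^ 2 + n.2.2 ^ 2 - n.1 * n.2.2 - n.2.1 * n.2.2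
        + a * n.1 + b * n.2.1 + c * n.2.2)‖ := by
  refine Summable.of_nonneg_of_le (fun n => by positivity) (fun n => ?_)
    (summable_gauss_three (T := -h.re / 4) (by linarith) (h * a).re (h * b).re (h * c).re k l)
  rw [norm_nome]
  gcongr
  have : h * ((n.1 : ℂ) ^ 2 + n.2.1 ^ 2 + n.2.2 ^ 2 - n.1 * n.2.2 - n.2.1 * n.2.2
        + a * n.1 + b * n.2.1 + c * n.2.2) =
      ((n.1 ^ 2 + n.2.1 ^ 2 + n.2.2 ^ 2 - n.1 * n.2.2 - n.2.1 * n.2.2 : ℝ) : ℂ) * h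
        + ((n.1 : ℝ) : ℂ) * (h * a) + ((n.2.1 : ℝ) : ℂ) * (h * b)
        + ((n.2.2 : ℝ) : ℂ) * (h * c) := by
    push_cast; ring
  rw [this, Complex.add_re, Complex.add_re, Complex.add_re, Complex.re_ofReal_mul,
    Complex.re_ofReal_mul, Complex.re_ofReal_mul, Complex.re_ofReal_mul]
  nlinarith [mul_nonneg (neg_nonneg.mpr hh.le) (sq_nonneg (3 * (n.1 : ℝ) - 2 * n.2.2)),
    mul_nonneg (neg_nonneg.mpr hh.le) (sq_nonneg (3 * (n.2.1 : ℝ) - 2 * n.2.2)),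
    mul_nonneg (neg_nonneg.mpr hh.le) (sq_nonneg (n.1 : ℝ)),
    mul_nonneg (neg_nonneg.mpr hh.le) (sq_nonneg (n.2.1 : ℝ)),
    mul_nonneg (neg_nonneg.mpr hh.le) (sq_nonneg (n.2.2 : ℝ))]

/-! ### Euler's identity -/

lemma one_sub_nome_mul_qInv {h : ℂ} (hh : h.re < 0) (n : ℤ) :
    (1 - nome h (2 * n)) * qInv (nome h 2) n = qInv (nome h 2) (n - 1) := by
  rw [← one_sub_mul_qInv (norm_nome_two_lt hh), nome_zpow, mul_comm (n : ℂ)]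

lemma summable_euler {h : ℂ} (hh : h.re < 0) (s : ℂ) :
    Summable fun n : ℤ => nome h (n ^ 2 + s * n) * qInv (nome h 2) n := by
  obtain ⟨C, hC0, hC⟩ := exists_norm_qInv_le (norm_nome_two_lt hh)
  refine Summable.of_norm_bounded ((summable_nome_sq hh s 0).mul_right C) fun n => ?_
  rw [norm_mul, pow_zero, one_mul]
  gcongr
  exact hC n

/-- Subtracting the series at s + 2 inserts the factor 1 - q^(2n), which lowers the denominator
index; shifting n gives back the series at s + 2. -/
lemma euler_step {h : ℂ} (hh : h.re < 0) (s : ℂ) :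
    ∑' n : ℤ, nome h (n ^ 2 + s * n) * qInv (nome h 2) n =
      (1 + nome h (s + 1)) * ∑' n : ℤ, nome h (n ^ 2 + (s + 2) * n) * qInv (nome h 2) n := by
  rw [one_add_mul, add_comm, ← sub_eq_iff_eq_add, ← (summable_euler hh s).tsum_sub
    (summable_euler hh (s + 2)), ← tsum_mul_left, ← (Equiv.addRight (1 : ℤ)).tsum_eq]
  refine tsum_congr fun n => ?_
  have e1 := one_sub_nome_mul_qInv hh (n + 1)
  rw [add_sub_cancel_right] at e1
  have e2 : nome h (s + 1) * nome h (n ^ 2 + (s + 2) * n) =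
      nome h (((n + 1 : ℤ) : ℂ) ^ 2 + s * ((n + 1 : ℤ) : ℂ)) := by
    rw [← nome_add]; congr 1; push_cast; ring
  have e3 : nome h (((n + 1 : ℤ) : ℂ) ^ 2 + (s + 2) * ((n + 1 : ℤ) : ℂ)) =
      nome h (((n + 1 : ℤ) : ℂ) ^ 2 + s * ((n + 1 : ℤ) : ℂ)) * nome h (2 * ((n + 1 : ℤ) : ℂ)) := by
    rw [← nome_add]; congr 1; ring
  simp only [Equiv.coe_addRight]
  rw [← e1, e3, ← e2]
  ring

/-- Terms with n < 0 are zero and those with n > 0 carry the decaying factor q^(2mn), so only n = 0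
survives; the case m = 0 dominates. -/
lemma tendsto_euler {h : ℂ} (hh : h.re < 0) (s : ℂ) :
    Filter.Tendsto (fun m : ℕ => ∑' n : ℤ, nome h (n ^ 2 + (s + 2 * m) * n) * qInv (nome h 2) n)
      Filter.atTop (nhds 1) := by
  obtain ⟨C, hC0, hC⟩ := exists_norm_qInv_le (norm_nome_two_lt hh)
  have e : ∀ (m : ℕ) (n : ℤ), nome h (n ^ 2 + (s + 2 * m) * n) =
      nome h (n ^ 2 + s * n) * nome h (2 * n) ^ m := fun m n => by
    rw [nome_pow, ← nome_add]; ring_nf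
  have key : ∀ n : ℤ, 0 < n → ‖nome h (2 * n)‖ < 1 := fun n hn => by
    have := norm_nome_lt_one hh (x := 2 * n) (by positivity)
    simpa using this
  have h1 := tendsto_tsum_of_dominated_convergence (𝓕 := Filter.atTop)
    (f := fun (m : ℕ) (n : ℤ) => nome h (n ^ 2 + (s + 2 * m) * n) * qInv (nome h 2) n)
    (g := fun n : ℤ => if n = 0 then 1 else 0) ((summable_nome_sq hh s 0).mul_right C)
    (fun n => ?_) (Filter.Eventually.of_forall fun m n => ?_)
  · rwa [tsum_ite_eq] at h1
  · rcases lt_trichotomy n 0 with hn | rfl | hn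
    · simp [qInv_of_neg _ hn, hn.ne]
    · simp
    · simp only [e, hn.ne', if_false]
      have := (tendsto_pow_atTop_nhds_zero_of_norm_lt_one (key n hn)).const_mul
        (nome h (n ^ 2 + s * n))
      simpa using this.mul_const (qInv (nome h 2) n)
  · rcases lt_or_ge n 0 with hn | hn
    · rw [qInv_of_neg _ hn, mul_zero, norm_zero]; positivity
    · rw [e, norm_mul, norm_mul, pow_zero, one_mul, norm_pow]
      gcongr
      · refine mul_le_of_le_one_right (norm_nonneg _) (pow_le_one₀ (norm_nonneg _) ?_)
        rcases hn.eq_or_lt with rfl | hn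
        · simp
        · exact (key n hn).le
      · exact hC n

/-- Euler's identity `∑ q ^ (n² + s n) / (q²; q²)_n = (-q ^ (s + 1); q²)_∞`. -/
theorem hasSum_euler {h : ℂ} (hh : h.re < 0) (s : ℂ) :
    HasSum (fun n : ℤ => nome h (n ^ 2 + s * n) * qInv (nome h 2) n)
      (qPochInf (-nome h (s + 1)) (nome h 2)) := by
  convert (summable_euler hh s).hasSum using 1
  have h1 : ∀ m : ℕ, ∑' n : ℤ, nome h (n ^ 2 + s * n) * qInv (nome h 2) n =
      qPoch (-nome h (s + 1)) (nome h 2) m *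
        ∑' n : ℤ, nome h (n ^ 2 + (s + 2 * m) * n) * qInv (nome h 2) n := fun m => by
    induction m with
    | zero => simp [qPoch]
    | succ m ih =>
      rw [ih, euler_step hh, qPoch, qPoch, prod_range_succ, mul_assoc, nome_pow, neg_mul,
        ← nome_add, sub_neg_eq_add]
      push_cast
      ring_nf
  have h2 := (tendsto_qPoch (norm_nome_two_lt hh) (-nome h (s + 1))).mul (tendsto_euler hh s)
  simp only [← h1, mul_one] at h2
  exact tendsto_nhds_unique h2 tendsto_const_nhds

/-! ### Durfee rectangles -/

lemma summable_durfee {h : ℂ} (hh : h.re < 0) (s : ℂ) (d : ℤ) :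
    Summable fun b : ℤ =>
      nome h (2 * b ^ 2 + s * b) * (qInv (nome h 2) b * qInv (nome h 2) (b + d)) := by
  obtain ⟨C, hC0, hC⟩ := exists_norm_qInv_le (norm_nome_two_lt hh)
  have h2 : (2 * h).re < 0 := by simp; linarith
  refine Summable.of_norm_bounded ((summable_nome_sq h2 (s / 2) 0).mul_right (C * C)) fun n => ?_
  rw [norm_mul, norm_mul, pow_zero, one_mul, nome_mul]
  gcongr
  · apply le_of_eq; ring_nf
  · exact hC n
  · exact hC _

/-- Both sides are compared with the mixed sum having the exponent of d + 1 and the denominators of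
d. The two differences agree termwise after b is shifted by one, so the sum is independent of d and
its value is the limit d → ∞. -/
lemma durfee_step {h : ℂ} (hh : h.re < 0) (d : ℤ) :
    ∑' b : ℤ, nome h (2 * b ^ 2 + 2 * d * b) * (qInv (nome h 2) b * qInv (nome h 2) (b + d)) =
      ∑' b : ℤ, nome h (2 * b ^ 2 + 2 * (d + 1 : ℤ) * b) *
        (qInv (nome h 2) b * qInv (nome h 2) (b + (d + 1))) := by
  have hS := summable_durfee hh (2 * (d + 1 : ℤ)) d
  rw [← sub_left_inj (a := ∑' b : ℤ, nome h (2 * b ^ 2 + 2 * (d + 1 : ℤ) * b) *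
    (qInv (nome h 2) b * qInv (nome h 2) (b + d))), ← (summable_durfee hh _ d).tsum_sub hS,
    ← (summable_durfee hh _ (d + 1)).tsum_sub hS, ← (Equiv.addRight (1 : ℤ)).tsum_eq]
  refine tsum_congr fun n => ?_
  have e1 := one_sub_nome_mul_qInv hh (n + 1)
  have e2 := one_sub_nome_mul_qInv hh (n + (d + 1))
  rw [add_sub_cancel_right] at e1
  rw [show n + (d + 1) - 1 = n + d by ring] at e2
  rw [Equiv.coe_addRight, show n + 1 + d = n + (d + 1) by ring, ← e1, ← e2,
    show 2 * ((n + 1 : ℤ) : ℂ) ^ 2 + 2 * d * ((n + 1 : ℤ) : ℂ) =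
      (2 * n ^ 2 + 2 * (d + 1 : ℤ) * n) + 2 * ((n + (d + 1) : ℤ) : ℂ) by push_cast; ring,
    show 2 * ((n + 1 : ℤ) : ℂ) ^ 2 + 2 * (d + 1 : ℤ) * ((n + 1 : ℤ) : ℂ) =
      (2 * n ^ 2 + 2 * (d + 1 : ℤ) * n) + 2 * ((n + (d + 1) : ℤ) : ℂ) + 2 * ((n + 1 : ℤ) : ℂ) by
      push_cast; ring]
  simp only [nome_add]
  ring

lemma tendsto_durfee {h : ℂ} (hh : h.re < 0) :
    Filter.Tendsto (fun m : ℕ => ∑' b : ℤ, nome h (2 * b ^ 2 + 2 * (m : ℤ) * b) *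
        (qInv (nome h 2) b * qInv (nome h 2) (b + m)))
      Filter.atTop (nhds (qPochInf (nome h 2) (nome h 2))⁻¹) := by
  obtain ⟨C, hC0, hC⟩ := exists_norm_qInv_le (norm_nome_two_lt hh)
  have e : ∀ (m : ℕ) (n : ℤ), nome h (2 * n ^ 2 + 2 * (m : ℤ) * n) =
      nome h (2 * n ^ 2) * nome h (2 * n) ^ m := fun m n => by
    rw [nome_pow, ← nome_add]; push_cast; ring_nf
  have key : ∀ n : ℤ, 0 < n → ‖nome h (2 * n)‖ < 1 := fun n hn => by
    have := norm_nome_lt_one hh (x := 2 * n) (by positivity)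
    simpa using this
  have h2 : (2 * h).re < 0 := by simp; linarith
  have hb : Summable fun n : ℤ => ‖nome h (2 * n ^ 2)‖ * (C * C) := by
    refine ((summable_nome_sq h2 0 0).mul_right (C * C)).congr fun n => ?_
    rw [nome_mul, pow_zero, one_mul, zero_mul, add_zero]
  have h1 := tendsto_tsum_of_dominated_convergence (𝓕 := Filter.atTop)
    (f := fun (m : ℕ) (b : ℤ) => nome h (2 * b ^ 2 + 2 * (m : ℤ) * b) *
        (qInv (nome h 2) b * qInv (nome h 2) (b + m)))
    (g := fun n : ℤ => if n = 0 then (qPochInf (nome h 2) (nome h 2))⁻¹ else 0) hb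
    (fun n => ?_) (Filter.Eventually.of_forall fun m n => ?_)
  · rwa [tsum_ite_eq] at h1
  · rcases lt_trichotomy n 0 with hn | rfl | hn
    · simp [qInv_of_neg _ hn, hn.ne]
    · simpa using tendsto_qInv (norm_nome_two_lt hh)
    · simp only [hn.ne', if_false]
      have := ((tendsto_pow_atTop_nhds_zero_of_norm_lt_one (key n hn)).norm.const_mul
        ‖nome h (2 * n ^ 2)‖).mul_const (C * C)
      rw [norm_zero, mul_zero, zero_mul] at this
      refine squeeze_zero_norm (fun m => ?_) this
      rw [e, norm_mul, norm_mul, norm_mul]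
      gcongr
      · exact hC n
      · exact hC _
  · rcases lt_or_ge n 0 with hn | hn
    · rw [qInv_of_neg _ hn, zero_mul, mul_zero, norm_zero]; positivity
    · rw [e, norm_mul, norm_mul, norm_mul, norm_pow]
      gcongr
      · refine mul_le_of_le_one_right (norm_nonneg _) (pow_le_one₀ (norm_nonneg _) ?_)
        rcases hn.eq_or_lt with rfl | hn
        · simp
        · exact (key n hn).le
      · exact hC n
      · exact hC _

lemma eq_zero_of_forall_eq_succ {D : ℤ → ℂ} (hs : ∀ d, D d = D (d + 1)) (d : ℤ) : D d = D 0 := by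
  induction d with
  | zero => rfl
  | succ n ih => rw [← hs, ih]
  | pred n ih => rw [hs, sub_add_cancel, ih]

/-- `∑_{a - b = d} Q ^ (a b) / ((Q; Q)_a (Q; Q)_b) = 1 / (Q; Q)_∞` with `Q = q²`. -/
theorem hasSum_durfee {h : ℂ} (hh : h.re < 0) (d : ℤ) :
    HasSum (fun b : ℤ =>
      nome h (2 * b ^ 2 + 2 * d * b) * (qInv (nome h 2) b * qInv (nome h 2) (b + d)))
      (qPochInf (nome h 2) (nome h 2))⁻¹ := by
  let D : ℤ → ℂ := fun d => ∑' b : ℤ,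
    nome h (2 * b ^ 2 + 2 * d * b) * (qInv (nome h 2) b * qInv (nome h 2) (b + d))
  have h0 : ∀ d, D d = D 0 := eq_zero_of_forall_eq_succ (D := D) (durfee_step hh)
  have h1 : Filter.Tendsto (fun m : ℕ => D m) Filter.atTop
    (nhds (qPochInf (nome h 2) (nome h 2))⁻¹) := tendsto_durfee hh
  have h2 : (fun m : ℕ => D m) = fun _ => D d := funext fun m => by rw [h0, h0 d]
  rw [h2] at h1
  rw [tendsto_nhds_unique h1 tendsto_const_nhds]
  exact (summable_durfee hh (2 * d) d).hasSum

/-! ### Jacobi's triple product -/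

/-- The shear `(d, b) ↦ (b + d, b)` of `ℤ × ℤ`. -/
def shearEquiv : ℤ × ℤ ≃ ℤ × ℤ where
  toFun n := (n.2 + n.1, n.2)
  invFun n := (n.1 - n.2, n.2)
  left_inv n := by simp
  right_inv n := by simp

lemma hasSum_of_hasSum_shear {f : ℤ × ℤ → ℂ} {g : ℤ → ℂ} {a : ℂ} (hf : HasSum f a)
    (hg : ∀ d : ℤ, HasSum (fun b : ℤ => f (b + d, b)) (g d)) : HasSum g a :=
  ((shearEquiv.hasSum_iff (f := f)).mpr hf).prod_fiberwise hg

lemma HasSum.mul_complex {ι κ : Type*} {f : ι → ℂ} {g : κ → ℂ} {a b : ℂ} (hf : HasSum f a)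
    (hg : HasSum g b) : HasSum (fun n : ι × κ => f n.1 * g n.2) (a * b) :=
  hf.mul hg (summable_mul_of_summable_norm hf.summable.norm hg.summable.norm)

/-- Multiply the Euler sums at s and -s and group the terms by the difference n of the indices: each
group is q^(n²+sn) times a Durfee sum. -/
theorem hasSum_theta {h : ℂ} (hh : h.re < 0) (s : ℂ) :
    HasSum (fun n : ℤ => nome h (n ^ 2 + s * n))
      (qPochInf (-nome h (1 + s)) (nome h 2) * qPochInf (-nome h (1 - s)) (nome h 2)
        * qPochInf (nome h 2) (nome h 2)) := by
  have hne := qPochInf_self_ne_zero (norm_nome_two_lt hh)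
  have h1 := (hasSum_euler hh s).mul_complex (hasSum_euler hh (-s))
  have h2 := hasSum_of_hasSum_shear h1
    (g := fun n : ℤ => nome h (n ^ 2 + s * n) * (qPochInf (nome h 2) (nome h 2))⁻¹) fun n => by
    refine ((hasSum_durfee hh n).mul_left (nome h (n ^ 2 + s * n))).congr_fun fun b => ?_
    have e : nome h (((b + n : ℤ) : ℂ) ^ 2 + s * ((b + n : ℤ) : ℂ)) * nome h (b ^ 2 + -s * b) =
        nome h (n ^ 2 + s * n) * nome h (2 * b ^ 2 + 2 * n * b) := by
      rw [← nome_add, ← nome_add]; congr 1; push_cast; ring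
    linear_combination qInv (nome h 2) b * qInv (nome h 2) (b + n) * e
  have h3 := h2.mul_right (qPochInf (nome h 2) (nome h 2))
  rw [add_comm (-s), ← sub_eq_add_neg, add_comm s] at h3
  exact h3.congr_fun fun n => by rw [inv_mul_cancel_right₀ hne]

/-! ### The ternary sums and their contiguity relations -/

/-- The summand `q ^ (i² + j² + k² - i k - j k + a i + b j + c k) / ((q²; q²)_i (q²; q²)_j (q²; q²)_k)`,
extended by zero to all integers. -/
noncomputable def ternTerm (h a b c : ℂ) (n : ℤ × ℤ × ℤ) : ℂ :=
  nome h (n.1 ^ 2 + n.2.1 ^ 2 + n.2.2 ^ 2 - n.1 * n.2.2 - n.2.1 * n.2.2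
    + a * n.1 + b * n.2.1 + c * n.2.2) *
    (qInv (nome h 2) n.1 * qInv (nome h 2) n.2.1 * qInv (nome h 2) n.2.2)

/-- The sum of `ternTerm h a b c`. -/
noncomputable def ternSum (h a b c : ℂ) : ℂ := ∑' n, ternTerm h a b c n

lemma exists_norm_ternTerm_le {h : ℂ} (hh : h.re < 0) (a b c : ℂ) : ∃ C : ℝ, 0 ≤ C ∧
    ∀ n : ℤ × ℤ × ℤ, ‖ternTerm h a b c n‖ ≤
      ‖nome h (n.1 ^ 2 + n.2.1 ^ 2 + n.2.2 ^ 2 - n.1 * n.2.2 - n.2.1 * n.2.2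
        + a * n.1 + b * n.2.1 + c * n.2.2)‖ * C := by
  obtain ⟨C, hC0, hC⟩ := exists_norm_qInv_le (norm_nome_two_lt hh)
  refine ⟨C * C * C, by positivity, fun n => ?_⟩
  rw [ternTerm, norm_mul, norm_mul, norm_mul]
  gcongr
  · exact hC _
  · exact hC _
  · exact hC _

lemma summable_ternTerm {h : ℂ} (hh : h.re < 0) (a b c : ℂ) : Summable (ternTerm h a b c) := by
  obtain ⟨C, hC0, hC⟩ := exists_norm_ternTerm_le hh a b c
  refine Summable.of_norm_bounded ((summable_nome_ternary hh a b c 0 0).mul_right C) fun n => ?_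
  simpa only [pow_zero, one_mul] using hC n

lemma summable_sub_mul_ternTerm {h : ℂ} (hh : h.re < 0) (a b c : ℂ) :
    Summable fun n : ℤ × ℤ × ℤ => ((n.1 : ℂ) - n.2.1) * ternTerm h a b c n := by
  obtain ⟨C, hC0, hC⟩ := exists_norm_ternTerm_le hh a b c
  simp only [sub_mul]
  refine Summable.sub (Summable.of_norm_bounded
    ((summable_nome_ternary hh a b c 1 0).mul_right C) fun n => ?_) (Summable.of_norm_bounded
    ((summable_nome_ternary hh a b c 0 1).mul_right C) fun n => ?_)
  · rw [norm_mul, Complex.norm_intCast, pow_one, pow_zero, mul_one, mul_assoc]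
    gcongr
    exact hC n
  · rw [norm_mul, Complex.norm_intCast, pow_one, pow_zero, one_mul, mul_assoc]
    gcongr
    exact hC n

/-- The exchange of the first two coordinates. -/
def swapEquiv : ℤ × ℤ × ℤ ≃ ℤ × ℤ × ℤ where
  toFun n := (n.2.1, n.1, n.2.2)
  invFun n := (n.2.1, n.1, n.2.2)
  left_inv _ := rfl
  right_inv _ := rfl

lemma ternTerm_swap (h a b c : ℂ) (n : ℤ × ℤ × ℤ) :
    ternTerm h a b c (swapEquiv n) = ternTerm h b a c n := by
  simp only [ternTerm, swapEquiv, Equiv.coe_fn_mk]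
  ring_nf

lemma ternSum_swap (h a b c : ℂ) : ternSum h a b c = ternSum h b a c := by
  rw [ternSum, ← swapEquiv.tsum_eq]
  exact tsum_congr (ternTerm_swap h a b c)

lemma tsum_sub_mul_ternTerm_self (h a c : ℂ) :
    ∑' n : ℤ × ℤ × ℤ, ((n.1 : ℂ) - n.2.1) * ternTerm h a a c n = 0 := by
  have e := swapEquiv.tsum_eq fun n : ℤ × ℤ × ℤ => ((n.1 : ℂ) - n.2.1) * ternTerm h a a c n
  have e2 : ∀ n : ℤ × ℤ × ℤ, (((swapEquiv n).1 : ℂ) - (swapEquiv n).2.1) *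
      ternTerm h a a c (swapEquiv n) = -(((n.1 : ℂ) - n.2.1) * ternTerm h a a c n) := fun n => by
    rw [ternTerm_swap]; simp only [swapEquiv, Equiv.coe_fn_mk]; ring
  simp only [e2, tsum_neg] at e
  linear_combination -e / 2

/-- The translation of the first coordinate. -/
def shiftFst : ℤ × ℤ × ℤ ≃ ℤ × ℤ × ℤ where
  toFun n := (n.1 + 1, n.2)
  invFun n := (n.1 - 1, n.2)
  left_inv n := by simp
  right_inv n := by simp

/-- The translation of the third coordinate. -/
def shiftThd : ℤ × ℤ × ℤ ≃ ℤ × ℤ × ℤ where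
  toFun n := (n.1, n.2.1, n.2.2 + 1)
  invFun n := (n.1, n.2.1, n.2.2 - 1)
  left_inv n := by simp
  right_inv n := by simp

lemma ternTerm_shiftFst {h : ℂ} (hh : h.re < 0) (a b c : ℂ) (n : ℤ × ℤ × ℤ) :
    ternTerm h a b c (shiftFst n) - ternTerm h (a + 2) b c (shiftFst n) =
      nome h (a + 1) * ternTerm h (a + 2) b (c - 1) n := by
  obtain ⟨i, j, k⟩ := n
  have e1 := one_sub_nome_mul_qInv hh (i + 1)
  rw [add_sub_cancel_right] at e1
  simp only [ternTerm, shiftFst, Equiv.coe_fn_mk]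
  rw [← e1, ← mul_assoc (nome h (a + 1)), ← nome_add,
    show a + 1 + ((i : ℂ) ^ 2 + j ^ 2 + k ^ 2 - i * k - j * k + (a + 2) * i + b * j + (c - 1) * k) =
      ((i + 1 : ℤ) : ℂ) ^ 2 + j ^ 2 + k ^ 2 - ((i + 1 : ℤ) : ℂ) * k - j * k
        + a * ((i + 1 : ℤ) : ℂ) + b * j + c * k by push_cast; ring,
    show ((i + 1 : ℤ) : ℂ) ^ 2 + j ^ 2 + k ^ 2 - ((i + 1 : ℤ) : ℂ) * k - j * k
        + (a + 2) * ((i + 1 : ℤ) : ℂ) + b * j + c * k =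
      (((i + 1 : ℤ) : ℂ) ^ 2 + j ^ 2 + k ^ 2 - ((i + 1 : ℤ) : ℂ) * k - j * k
        + a * ((i + 1 : ℤ) : ℂ) + b * j + c * k) + 2 * ((i + 1 : ℤ) : ℂ) by ring, nome_add _ _ (2 * _)]
  ring

lemma ternTerm_shiftThd {h : ℂ} (hh : h.re < 0) (a b c : ℂ) (n : ℤ × ℤ × ℤ) :
    ternTerm h a b c (shiftThd n) - ternTerm h a b (c + 2) (shiftThd n) =
      nome h (c + 1) * ternTerm h (a - 1) (b - 1) (c + 2) n := by
  obtain ⟨i, j, k⟩ := n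
  have e1 := one_sub_nome_mul_qInv hh (k + 1)
  rw [add_sub_cancel_right] at e1
  simp only [ternTerm, shiftThd, Equiv.coe_fn_mk]
  rw [← e1, ← mul_assoc (nome h (c + 1)), ← nome_add,
    show c + 1 + ((i : ℂ) ^ 2 + j ^ 2 + k ^ 2 - i * k - j * k + (a - 1) * i + (b - 1) * j
        + (c + 2) * k) =
      (i : ℂ) ^ 2 + j ^ 2 + ((k + 1 : ℤ) : ℂ) ^ 2 - i * ((k + 1 : ℤ) : ℂ) - j * ((k + 1 : ℤ) : ℂ)
        + a * i + b * j + c * ((k + 1 : ℤ) : ℂ) by push_cast; ring,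
    show (i : ℂ) ^ 2 + j ^ 2 + ((k + 1 : ℤ) : ℂ) ^ 2 - i * ((k + 1 : ℤ) : ℂ)
        - j * ((k + 1 : ℤ) : ℂ) + a * i + b * j + (c + 2) * ((k + 1 : ℤ) : ℂ) =
      ((i : ℂ) ^ 2 + j ^ 2 + ((k + 1 : ℤ) : ℂ) ^ 2 - i * ((k + 1 : ℤ) : ℂ)
        - j * ((k + 1 : ℤ) : ℂ) + a * i + b * j + c * ((k + 1 : ℤ) : ℂ)) + 2 * ((k + 1 : ℤ) : ℂ)
      by ring, nome_add _ _ (2 * _)]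
  ring

lemma ternSum_sub_fst {h : ℂ} (hh : h.re < 0) (a b c : ℂ) :
    ternSum h a b c - ternSum h (a + 2) b c = nome h (a + 1) * ternSum h (a + 2) b (c - 1) := by
  rw [ternSum, ternSum, ternSum, ← (summable_ternTerm hh a b c).tsum_sub
    (summable_ternTerm hh (a + 2) b c), ← shiftFst.tsum_eq, ← tsum_mul_left]
  exact tsum_congr (ternTerm_shiftFst hh a b c)

lemma ternSum_sub_snd {h : ℂ} (hh : h.re < 0) (a b c : ℂ) :
    ternSum h a b c - ternSum h a (b + 2) c = nome h (b + 1) * ternSum h a (b + 2) (c - 1) := by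
  rw [ternSum_swap, ternSum_swap h a, ternSum_swap h a]
  exact ternSum_sub_fst hh b a c

lemma ternSum_sub_thd {h : ℂ} (hh : h.re < 0) (a b c : ℂ) :
    ternSum h a b c - ternSum h a b (c + 2) = nome h (c + 1) * ternSum h (a - 1) (b - 1) (c + 2) := by
  rw [ternSum, ternSum, ternSum, ← (summable_ternTerm hh a b c).tsum_sub
    (summable_ternTerm hh a b (c + 2)), ← shiftThd.tsum_eq, ← tsum_mul_left]
  exact tsum_congr (ternTerm_shiftThd hh a b c)

/-- The shift i ↦ i + 1 changes the weight i - j into i - j + 1, which produces the extra unweighted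
sum. -/
lemma tsum_sub_mul_ternTerm_sub_fst {h : ℂ} (hh : h.re < 0) (a b c : ℂ) :
    ∑' n : ℤ × ℤ × ℤ, ((n.1 : ℂ) - n.2.1) * ternTerm h a b c n -
      ∑' n : ℤ × ℤ × ℤ, ((n.1 : ℂ) - n.2.1) * ternTerm h (a + 2) b c n =
    nome h (a + 1) * (∑' n : ℤ × ℤ × ℤ, ((n.1 : ℂ) - n.2.1) * ternTerm h (a + 2) b (c - 1) n
      + ternSum h (a + 2) b (c - 1)) := by
  rw [ternSum, ← (summable_sub_mul_ternTerm hh a b c).tsum_sub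
    (summable_sub_mul_ternTerm hh (a + 2) b c), ← shiftFst.tsum_eq,
    ← (summable_sub_mul_ternTerm hh (a + 2) b (c - 1)).tsum_add (summable_ternTerm hh _ _ _),
    ← tsum_mul_left]
  refine tsum_congr fun n => ?_
  rw [← mul_sub, ternTerm_shiftFst hh]
  simp only [shiftFst, Equiv.coe_fn_mk]
  push_cast
  ring

/-! ### The diagonal sums with fixed `j - i` -/

lemma summable_nome_two_sq_mul {h : ℂ} (hh : h.re < 0) (s t : ℂ) {C : ℝ} {u : ℤ → ℂ}
    (hu : ∀ n, ‖u n‖ ≤ C) : Summable fun n : ℤ => nome h (2 * n ^ 2 + s * n + t) * u n := by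
  have h2 : (2 * h).re < 0 := by simp; linarith
  refine Summable.of_norm_bounded
    (((summable_nome_sq h2 (s / 2) 0).mul_right (‖nome h t‖ * C))) fun n => ?_
  rw [norm_mul, pow_zero, one_mul, nome_mul, nome_add, norm_mul, mul_assoc]
  gcongr
  · apply le_of_eq; ring_nf
  · exact hu n

/-- The sum over `i` with `j = i + N` and `k` fixed. -/
noncomputable def diagSum (h : ℂ) (N k : ℤ) : ℂ :=
  ∑' i : ℤ, nome h (2 * i ^ 2 + (2 * N - 2 * k) * i + (N ^ 2 - N * k)) *
    (qInv (nome h 2) i * qInv (nome h 2) (i + N))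

/-- The convolution over `a + b = k` which `diagSum` reduces to. -/
noncomputable def convSum (h : ℂ) (N k : ℤ) : ℂ :=
  ∑' a : ℤ, nome h (2 * a ^ 2 + (-2 * N - 2 * k) * a + (N ^ 2 + N * k + k ^ 2)) *
    (qInv (nome h 2) a * qInv (nome h 2) (k - a))

lemma summable_diagSum {h : ℂ} (hh : h.re < 0) (s t : ℂ) (N : ℤ) :
    Summable fun i : ℤ => nome h (2 * i ^ 2 + s * i + t) *
      (qInv (nome h 2) i * qInv (nome h 2) (i + N)) := by
  obtain ⟨C, hC0, hC⟩ := exists_norm_qInv_le (norm_nome_two_lt hh)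
  refine summable_nome_two_sq_mul hh s t (C := C * C) fun n => ?_
  rw [norm_mul]
  exact mul_le_mul (hC _) (hC _) (norm_nonneg _) hC0

lemma summable_convSum {h : ℂ} (hh : h.re < 0) (s t : ℂ) (k : ℤ) :
    Summable fun a : ℤ => nome h (2 * a ^ 2 + s * a + t) *
      (qInv (nome h 2) a * qInv (nome h 2) (k - a)) := by
  obtain ⟨C, hC0, hC⟩ := exists_norm_qInv_le (norm_nome_two_lt hh)
  refine summable_nome_two_sq_mul hh s t (C := C * C) fun n => ?_
  rw [norm_mul]
  exact mul_le_mul (hC _) (hC _) (norm_nonneg _) hC0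

/-- The difference of the two sums at N carries 1 - q^(2i); lowering i while i + N stays fixed
raises N by one. -/
lemma diagSum_add_one {h : ℂ} (hh : h.re < 0) (N k : ℤ) :
    diagSum h N (k + 1) =
      nome h (-N) * diagSum h N k + nome h (-(k + 1) - N) * diagSum h (N + 1) k := by
  have e1 : nome h (-N) * diagSum h N k =
      ∑' i : ℤ, nome h (2 * i ^ 2 + (2 * N - 2 * k) * i + (N ^ 2 - N * k - N)) *
        (qInv (nome h 2) i * qInv (nome h 2) (i + N)) := by
    rw [diagSum, ← tsum_mul_left]
    refine tsum_congr fun i => ?_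
    rw [← mul_assoc, ← nome_add]
    congr 2
    ring
  rw [← sub_eq_iff_eq_add', e1, diagSum, diagSum, ← (summable_diagSum hh _ _ N).tsum_sub
    (summable_diagSum hh _ _ N), ← tsum_mul_left, ← (Equiv.addRight (1 : ℤ)).tsum_eq]
  refine tsum_congr fun i => ?_
  have e1 := one_sub_nome_mul_qInv hh (i + 1)
  rw [add_sub_cancel_right] at e1
  simp only [Equiv.coe_addRight]
  rw [← e1, ← mul_assoc (nome h (-(k + 1) - N)), ← nome_add, show i + 1 + N = i + (N + 1) by ring,
    show -(k + 1) - N + (2 * (i : ℂ) ^ 2 + (2 * (N + 1 : ℤ) - 2 * k) * i +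
      ((N + 1 : ℤ) ^ 2 - (N + 1 : ℤ) * k)) =
      2 * ((i + 1 : ℤ) : ℂ) ^ 2 + (2 * N - 2 * (k + 1 : ℤ)) * ((i + 1 : ℤ) : ℂ)
        + (N ^ 2 - N * (k + 1 : ℤ)) by push_cast; ring,
    show 2 * ((i + 1 : ℤ) : ℂ) ^ 2 + (2 * N - 2 * k) * ((i + 1 : ℤ) : ℂ) + (N ^ 2 - N * k - N) =
      (2 * ((i + 1 : ℤ) : ℂ) ^ 2 + (2 * N - 2 * (k + 1 : ℤ)) * ((i + 1 : ℤ) : ℂ)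
        + (N ^ 2 - N * (k + 1 : ℤ))) + 2 * ((i + 1 : ℤ) : ℂ) by push_cast; ring,
    nome_add _ _ (2 * _)]
  ring

/-- Split 1 - q^(2(k+1)) as (1 - q^(2(k+1-a))) + q^(2(k+1-a)) (1 - q^(2a)); each part lowers one of
the two denominators. -/
lemma one_sub_mul_convSum {h : ℂ} (hh : h.re < 0) (N k : ℤ) :
    (1 - nome h (2 * (k + 1))) * convSum h N (k + 1) =
      nome h (2 * k + 1 - N) * convSum h N k + nome h (k - N) * convSum h (N + 1) k := by
  have e1 : nome h (k - N) * convSum h (N + 1) k =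
      ∑' a : ℤ, nome h (2 * a ^ 2 + (-2 * N - 2 * (k + 1)) * a
          + (N ^ 2 + N * (k + 1) + (k + 1) ^ 2)) *
        (1 - nome h (2 * (k + 1) - 2 * a)) *
        (qInv (nome h 2) a * qInv (nome h 2) (k + 1 - a)) := by
    rw [convSum, ← tsum_mul_left]
    refine tsum_congr fun a => ?_
    have e1 := one_sub_nome_mul_qInv hh (k + 1 - a)
    rw [show k + 1 - a - 1 = k - a by ring] at e1
    rw [← e1, ← mul_assoc, ← nome_add, show (k : ℂ) - N + (2 * (a : ℂ) ^ 2
      + (-2 * (N + 1 : ℤ) - 2 * k) * a + ((N + 1 : ℤ) ^ 2 + (N + 1 : ℤ) * k + k ^ 2)) =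
        2 * a ^ 2 + (-2 * N - 2 * (k + 1)) * a + (N ^ 2 + N * (k + 1) + (k + 1) ^ 2) by
        push_cast; ring,
      show 2 * ((k + 1 - a : ℤ) : ℂ) = 2 * (k + 1) - 2 * a by push_cast; ring]
    ring
  have e2 : nome h (2 * k + 1 - N) * convSum h N k =
      ∑' a : ℤ, nome h (2 * a ^ 2 + (-2 * N - 2 * (k + 1)) * a
          + (N ^ 2 + N * (k + 1) + (k + 1) ^ 2)) *
        (nome h (2 * (k + 1) - 2 * a) - nome h (2 * (k + 1))) *
        (qInv (nome h 2) a * qInv (nome h 2) (k + 1 - a)) := by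
    rw [convSum, ← tsum_mul_left]
    symm
    rw [← (Equiv.addRight (1 : ℤ)).tsum_eq]
    refine tsum_congr fun a => ?_
    have e1 := one_sub_nome_mul_qInv hh (a + 1)
    rw [add_sub_cancel_right] at e1
    simp only [Equiv.coe_addRight]
    rw [← e1, show k + 1 - (a + 1) = k - a by ring, ← mul_assoc (nome h (2 * k + 1 - N)),
      ← nome_add, mul_sub, ← nome_add, ← nome_add, ← mul_assoc _ (qInv _ (a + 1)),
      ← mul_assoc _ ((1 - _) * qInv _ (a + 1)), ← mul_assoc _ (1 - _), mul_one_sub, ← nome_add]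
    push_cast
    congr 4
    · ring
    · ring
  have s1 : Summable fun a : ℤ => nome h (2 * a ^ 2 + (-2 * N - 2 * (k + 1)) * a
          + (N ^ 2 + N * (k + 1) + (k + 1) ^ 2)) *
        (1 - nome h (2 * (k + 1) - 2 * a)) *
        (qInv (nome h 2) a * qInv (nome h 2) (k + 1 - a)) := by
    refine ((summable_convSum hh (-2 * N - 2 * (k + 1)) (N ^ 2 + N * (k + 1) + (k + 1) ^ 2)
      (k + 1)).sub (summable_convSum hh (-2 * N - 2 * (k + 1) - 2) (N ^ 2 + N * (k + 1)
        + (k + 1) ^ 2 + 2 * (k + 1)) (k + 1))).congr fun a => ?_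
    rw [← sub_mul, mul_one_sub, ← nome_add]
    congr 3
    ring_nf
  have s2 : Summable fun a : ℤ => nome h (2 * a ^ 2 + (-2 * N - 2 * (k + 1)) * a
          + (N ^ 2 + N * (k + 1) + (k + 1) ^ 2)) *
        (nome h (2 * (k + 1) - 2 * a) - nome h (2 * (k + 1))) *
        (qInv (nome h 2) a * qInv (nome h 2) (k + 1 - a)) := by
    refine ((summable_convSum hh (-2 * N - 2 * (k + 1) - 2) (N ^ 2 + N * (k + 1)
        + (k + 1) ^ 2 + 2 * (k + 1)) (k + 1)).sub (summable_convSum hh (-2 * N - 2 * (k + 1))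
        (N ^ 2 + N * (k + 1) + (k + 1) ^ 2 + 2 * (k + 1)) (k + 1))).congr fun a => ?_
    rw [← sub_mul, mul_sub, ← nome_add, ← nome_add]
    congr 3
    · ring_nf
    · ring_nf
  rw [e1, e2, ← s2.tsum_add s1, convSum, ← tsum_mul_left]
  refine tsum_congr fun a => ?_
  push_cast
  ring

/-- Both sides satisfy the same recurrence in k. It involves N + 1, so the induction runs over all N
at once; k = 0 is the Durfee identity. -/
lemma qInv_mul_diagSum_natCast {h : ℂ} (hh : h.re < 0) (k : ℕ) (N : ℤ) :
    qInv (nome h 2) k * nome h (k ^ 2) * diagSum h N k =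
      (qPochInf (nome h 2) (nome h 2))⁻¹ * convSum h N k := by
  induction k generalizing N with
  | zero =>
    have h1 : convSum h N 0 = nome h (N ^ 2) := by
      rw [convSum, tsum_eq_single 0]
      · simp
      · intro a ha
        rcases lt_or_gt_of_ne ha with ha | ha
        · simp [qInv_of_neg _ ha]
        · rw [qInv_of_neg _ (show 0 - a < 0 by lia), mul_zero, mul_zero]
    have h2 : diagSum h N 0 = nome h (N ^ 2) * (qPochInf (nome h 2) (nome h 2))⁻¹ := by
      rw [← ((hasSum_durfee hh N).mul_left (nome h (N ^ 2))).tsum_eq, diagSum]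
      refine tsum_congr fun i => ?_
      rw [← mul_assoc (nome h (N ^ 2)), ← nome_add]
      congr 2
      push_cast
      ring
    simp only [Nat.cast_zero, h1, h2]
    simp [mul_comm]
  | succ k ih =>
    have hne : 1 - nome h (2 * (k + 1)) ≠ 0 := by
      have := one_sub_pow_ne_zero (norm_nome_two_lt hh) k
      rwa [nome_pow, ← nome_add, show (2 : ℂ) + k * 2 = 2 * (k + 1) by ring] at this
    have e1 := one_sub_nome_mul_qInv hh (k + 1)
    rw [add_sub_cancel_right] at e1
    push_cast at e1 ⊢
    refine mul_left_cancel₀ hne ?_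
    have e2 := one_sub_mul_convSum hh N k
    push_cast at e2
    have e3 : nome h ((k + 1) ^ 2) * nome h (-N) = nome h (k ^ 2) * nome h (2 * k + 1 - N) := by
      rw [← nome_add, ← nome_add]; ring_nf
    have e4 : nome h ((k + 1) ^ 2) * nome h (-(k + 1) - N) = nome h (k ^ 2) * nome h (k - N) := by
      rw [← nome_add, ← nome_add]; ring_nf
    have e5 := diagSum_add_one hh N k
    push_cast at e5
    rw [e5]
    linear_combination nome h ((k + 1) ^ 2) * (nome h (-N) * diagSum h N k
      + nome h (-(k + 1) - N) * diagSum h (N + 1) k) * e1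
      + qInv (nome h 2) k * diagSum h N k * e3 + qInv (nome h 2) k * diagSum h (N + 1) k * e4
      + nome h (2 * k + 1 - N) * ih N + nome h (k - N) * ih (N + 1)
      - (qPochInf (nome h 2) (nome h 2))⁻¹ * e2

lemma qInv_mul_diagSum {h : ℂ} (hh : h.re < 0) (N k : ℤ) :
    qInv (nome h 2) k * nome h (k ^ 2) * diagSum h N k =
      (qPochInf (nome h 2) (nome h 2))⁻¹ * convSum h N k := by
  rcases lt_or_ge k 0 with hk | hk
  · have : convSum h N k = 0 := by
      rw [convSum, ← tsum_zero (α := ℂ) (β := ℤ)]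
      refine tsum_congr fun a => ?_
      rcases lt_or_ge a 0 with ha | ha
      · simp [qInv_of_neg _ ha]
      · simp [qInv_of_neg _ (show k - a < 0 by lia)]
    rw [this, qInv_of_neg _ hk, zero_mul, zero_mul, mul_zero]
  · lift k to ℕ using hk
    exact_mod_cast qInv_mul_diagSum_natCast hh k N

/-! ### The ternary sum as a hexagonal theta series -/

lemma summable_hex {h : ℂ} (hh : h.re < 0) (s t : ℂ) :
    Summable fun n : ℤ × ℤ => nome h (n.1 ^ 2 - n.1 * n.2 + n.2 ^ 2 + s * n.1 + t * n.2) := by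
  refine Summable.of_norm_bounded (summable_nome_hex hh s t 0 0) fun n => ?_
  rw [pow_zero, pow_zero, one_mul, one_mul]

lemma summable_fst_mul_hex {h : ℂ} (hh : h.re < 0) (s t : ℂ) :
    Summable fun n : ℤ × ℤ =>
      (n.1 : ℂ) * nome h (n.1 ^ 2 - n.1 * n.2 + n.2 ^ 2 + s * n.1 + t * n.2) := by
  refine Summable.of_norm_bounded (summable_nome_hex hh s t 1 0) fun n => ?_
  rw [pow_zero, pow_one, mul_one, norm_mul, Complex.norm_intCast]

/-- The pair of indices `(k, a) ↦ (a, k - a)`. -/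
def convEquiv : ℤ × ℤ ≃ ℤ × ℤ where
  toFun n := (n.2, n.1 - n.2)
  invFun n := (n.1 + n.2, n.1)
  left_inv n := by simp
  right_inv n := by simp

/-- One product of Euler sums is grouped in two ways: by a + b = k it gives the convolutions, by a -
b = d it gives Durfee sums. -/
lemma hasSum_convSum {h : ℂ} (hh : h.re < 0) (N : ℤ) :
    HasSum (convSum h N) ((qPochInf (nome h 2) (nome h 2))⁻¹ *
      ∑' d : ℤ, nome h (N ^ 2 - N * d + d ^ 2)) := by
  have h1 := ((hasSum_euler hh (-N)).mul_complex (hasSum_euler hh N)).mul_left (nome h (N ^ 2))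
  set S := nome h (N ^ 2) * (qPochInf (-nome h (-N + 1)) (nome h 2) *
    qPochInf (-nome h (N + 1)) (nome h 2)) with hS
  have h2 : HasSum (convSum h N) S := by
    refine ((convEquiv.hasSum_iff).mpr h1).prod_fiberwise fun k => ?_
    refine (summable_convSum hh (-2 * N - 2 * k) (N ^ 2 + N * k + k ^ 2) k).hasSum.congr_fun
      fun a => ?_
    simp only [Function.comp, convEquiv, Equiv.coe_fn_mk]
    rw [mul_mul_mul_comm, ← nome_add, ← mul_assoc, ← nome_add]
    congr 2
    push_cast
    ring
  have h3 : HasSum (fun d : ℤ => nome h (N ^ 2 - N * d + d ^ 2) *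
      (qPochInf (nome h 2) (nome h 2))⁻¹) S := by
    refine hasSum_of_hasSum_shear h1 fun d => ?_
    refine ((hasSum_durfee hh d).mul_left (nome h (N ^ 2 - N * d + d ^ 2))).congr_fun fun b => ?_
    have e : nome h (N ^ 2) * (nome h (((b + d : ℤ) : ℂ) ^ 2 + -N * ((b + d : ℤ) : ℂ)) *
        nome h (b ^ 2 + N * b)) =
        nome h (N ^ 2 - N * d + d ^ 2) * nome h (2 * b ^ 2 + 2 * d * b) := by
      rw [← nome_add, ← nome_add, ← nome_add]; congr 1; push_cast; ring
    linear_combination qInv (nome h 2) b * qInv (nome h 2) (b + d) * e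
  rw [mul_comm, ← tsum_mul_right, h3.tsum_eq]
  exact h2

/-- The indices `(i, i + N, k)` in terms of `(N, k, i)`. -/
def diagEquiv : ℤ × ℤ × ℤ ≃ ℤ × ℤ × ℤ where
  toFun n := (n.2.2, n.2.2 + n.1, n.2.1)
  invFun n := (n.2.1 - n.1, n.2.2, n.1)
  left_inv n := by simp
  right_inv n := by simp

lemma hasSum_ternTerm_diag {h : ℂ} (hh : h.re < 0) (N : ℤ) :
    HasSum (fun n : ℤ × ℤ => ternTerm h 0 0 0 (diagEquiv (N, n)))
      ((qPochInf (nome h 2) (nome h 2))⁻¹ ^ 2 * ∑' d : ℤ, nome h (N ^ 2 - N * d + d ^ 2)) := by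
  have hs : Summable fun n : ℤ × ℤ => ternTerm h 0 0 0 (diagEquiv (N, n)) :=
    (diagEquiv.summable_iff.mpr (summable_ternTerm hh 0 0 0)).prod_factor N
  have h1 := hs.hasSum.prod_fiberwise
    (g := fun k => (qPochInf (nome h 2) (nome h 2))⁻¹ * convSum h N k) fun k => by
    rw [← qInv_mul_diagSum hh]
    refine ((summable_diagSum hh (2 * N - 2 * k) (N ^ 2 - N * k) N).hasSum.mul_left
      (qInv (nome h 2) k * nome h (k ^ 2))).congr_fun fun i => ?_
    simp only [ternTerm, diagEquiv, Equiv.coe_fn_mk]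
    have e : nome h ((i : ℂ) ^ 2 + ((i + N : ℤ) : ℂ) ^ 2 + k ^ 2 - i * k - ((i + N : ℤ) : ℂ) * k
        + 0 * i + 0 * ((i + N : ℤ) : ℂ) + 0 * k) =
        nome h (k ^ 2) * nome h (2 * i ^ 2 + (2 * N - 2 * k) * i + (N ^ 2 - N * k)) := by
      rw [← nome_add]; congr 1; push_cast; ring
    rw [e]
    ring
  have h2 := h1.unique ((hasSum_convSum hh N).mul_left (qPochInf (nome h 2) (nome h 2))⁻¹)
  rw [sq, mul_assoc, ← h2]
  exact hs.hasSum

/-- The inner sum at fixed N = j - i is known, so any weight in N may be inserted: q^(sN) gives the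
sums themselves, N q^(sN) their first moments. -/
lemma tsum_mul_ternTerm {h : ℂ} (hh : h.re < 0) {g : ℤ → ℂ}
    (h1 : Summable fun n : ℤ × ℤ × ℤ => g (n.2.1 - n.1) * ternTerm h 0 0 0 n)
    (h2 : Summable fun n : ℤ × ℤ => g n.1 * nome h (n.1 ^ 2 - n.1 * n.2 + n.2 ^ 2)) :
    ∑' n : ℤ × ℤ × ℤ, g (n.2.1 - n.1) * ternTerm h 0 0 0 n =
      (qPochInf (nome h 2) (nome h 2))⁻¹ ^ 2 *
        ∑' n : ℤ × ℤ, g n.1 * nome h (n.1 ^ 2 - n.1 * n.2 + n.2 ^ 2) := by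
  rw [h2.tsum_prod, ← tsum_mul_left]
  refine ((diagEquiv.hasSum_iff.mpr h1.hasSum).prod_fiberwise fun N => ?_).tsum_eq.symm
  dsimp only
  rw [tsum_mul_left, ← mul_assoc, mul_comm (_ ^ 2), mul_assoc]
  refine ((hasSum_ternTerm_diag hh N).mul_left (g N)).congr_fun fun n => ?_
  simp [diagEquiv]

lemma nome_mul_ternTerm (h s : ℂ) (n : ℤ × ℤ × ℤ) :
    nome h (s * (n.2.1 - n.1 : ℤ)) * ternTerm h 0 0 0 n = ternTerm h (-s) s 0 n := by
  rw [ternTerm, ternTerm, ← mul_assoc, ← nome_add]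
  congr 2
  push_cast
  ring

lemma nome_mul_hex (h s : ℂ) (n : ℤ × ℤ) :
    nome h (s * n.1) * nome h (n.1 ^ 2 - n.1 * n.2 + n.2 ^ 2) =
      nome h (n.1 ^ 2 - n.1 * n.2 + n.2 ^ 2 + s * n.1 + 0 * n.2) := by
  rw [← nome_add]
  ring_nf

/-- The hexagonal theta series `∑ q ^ (N² - N d + d² + s N + t d)`. -/
noncomputable def hexSum (h s t : ℂ) : ℂ :=
  ∑' n : ℤ × ℤ, nome h (n.1 ^ 2 - n.1 * n.2 + n.2 ^ 2 + s * n.1 + t * n.2)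

theorem ternSum_neg_self {h : ℂ} (hh : h.re < 0) (s : ℂ) :
    ternSum h (-s) s 0 = hexSum h s 0 / qPochInf (nome h 2) (nome h 2) ^ 2 := by
  have := tsum_mul_ternTerm hh (g := fun N => nome h (s * N))
    ((summable_ternTerm hh (-s) s 0).congr fun n => (nome_mul_ternTerm h s n).symm)
    ((summable_hex hh s 0).congr fun n => (nome_mul_hex h s n).symm)
  simp only [nome_mul_ternTerm, nome_mul_hex] at this
  rw [ternSum, this, hexSum, inv_pow, mul_comm, div_eq_mul_inv]

theorem tsum_sub_mul_ternTerm_neg_self {h : ℂ} (hh : h.re < 0) (s : ℂ) :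
    ∑' n : ℤ × ℤ × ℤ, ((n.1 : ℂ) - n.2.1) * ternTerm h (-s) s 0 n =
      -(∑' n : ℤ × ℤ, (n.1 : ℂ) * nome h (n.1 ^ 2 - n.1 * n.2 + n.2 ^ 2 + s * n.1 + 0 * n.2)) /
        qPochInf (nome h 2) (nome h 2) ^ 2 := by
  have e1 : ∀ n : ℤ × ℤ × ℤ, ((n.2.1 - n.1 : ℤ) : ℂ) * nome h (s * (n.2.1 - n.1 : ℤ)) *
      ternTerm h 0 0 0 n = -(((n.1 : ℂ) - n.2.1) * ternTerm h (-s) s 0 n) := fun n => by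
    rw [mul_assoc, nome_mul_ternTerm]; push_cast; ring
  have e2 : ∀ n : ℤ × ℤ, (n.1 : ℂ) * nome h (s * n.1) * nome h (n.1 ^ 2 - n.1 * n.2 + n.2 ^ 2) =
      (n.1 : ℂ) * nome h (n.1 ^ 2 - n.1 * n.2 + n.2 ^ 2 + s * n.1 + 0 * n.2) := fun n => by
    rw [mul_assoc, nome_mul_hex]
  have := tsum_mul_ternTerm hh (g := fun N => N * nome h (s * N))
    ((summable_sub_mul_ternTerm hh (-s) s 0).neg.congr fun n => (e1 n).symm)
    ((summable_fst_mul_hex hh s 0).congr fun n => (e2 n).symm)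
  simp only [e1, e2, tsum_neg] at this
  rw [eq_comm, neg_div, neg_eq_iff_eq_neg, this, inv_pow, mul_comm, div_eq_mul_inv]

/-! ### Theta series in one variable -/

/-- The theta series `∑ q ^ (n² + s n)`. -/
noncomputable def thetaSum (h s : ℂ) : ℂ := ∑' n : ℤ, nome h (n ^ 2 + s * n)

lemma thetaSum_eq {h : ℂ} (hh : h.re < 0) (s : ℂ) :
    thetaSum h s = qPochInf (-nome h (1 + s)) (nome h 2) * qPochInf (-nome h (1 - s)) (nome h 2)
        * qPochInf (nome h 2) (nome h 2) := (hasSum_theta hh s).tsum_eq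

lemma hasSum_thetaSum {h : ℂ} (hh : h.re < 0) (s : ℂ) :
    HasSum (fun n : ℤ => nome h (n ^ 2 + s * n)) (thetaSum h s) := (hasSum_theta hh s).summable.hasSum

lemma thetaSum_neg (h s : ℂ) : thetaSum h (-s) = thetaSum h s := by
  rw [thetaSum, ← (Equiv.neg ℤ).tsum_eq]
  refine tsum_congr fun n => ?_
  simp only [Equiv.neg_apply]
  push_cast
  ring_nf

lemma thetaSum_add_two (h s : ℂ) : thetaSum h (s + 2) = nome h (-1 - s) * thetaSum h s := by
  rw [thetaSum, thetaSum, ← tsum_mul_left, ← (Equiv.subRight (1 : ℤ)).tsum_eq]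
  refine tsum_congr fun n => ?_
  rw [← nome_add, Equiv.subRight_apply]
  push_cast
  ring_nf

lemma thetaSum_congr {h s t : ℂ} (hst : nome h s = nome h t) : thetaSum h s = thetaSum h t := by
  refine tsum_congr fun n => ?_
  rw [nome_add, nome_add, mul_comm s, mul_comm t, ← nome_zpow, ← nome_zpow, hst]

lemma hasSum_of_bijective_sumElim {φ ψ : ℤ × ℤ → ℤ × ℤ} (hb : Function.Bijective (Sum.elim φ ψ))
    {f : ℤ × ℤ → ℂ} {a b : ℂ} (ha : HasSum (fun n => f (φ n)) a)
    (hb' : HasSum (fun n => f (ψ n)) b) : HasSum f (a + b) :=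
  (Equiv.ofBijective _ hb).hasSum_iff.mp (HasSum.sum (f := f ∘ Sum.elim φ ψ) ha hb')

lemma bijective_parity_snd : Function.Bijective (Sum.elim
    (fun n : ℤ × ℤ => (n.1 + n.2, 2 * n.2)) fun n : ℤ × ℤ => (n.1 + n.2, 2 * n.2 + 1)) := by
  constructor
  · rintro (⟨a, b⟩ | ⟨a, b⟩) (⟨c, d⟩ | ⟨c, d⟩) hab <;>
      simp only [Sum.elim_inl, Sum.elim_inr, Prod.mk.injEq] at hab
    · rw [show a = c by lia, show b = d by lia]
    · lia
    · lia
    · rw [show a = c by lia, show b = d by lia]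
  · rintro ⟨a, b⟩
    obtain ⟨c, rfl | rfl⟩ := Int.even_or_odd' b
    · exact ⟨Sum.inl (a - c, c), by simp⟩
    · exact ⟨Sum.inr (a - c, c), by simp⟩

lemma bijective_parity_add : Function.Bijective (Sum.elim
    (fun n : ℤ × ℤ => (n.1 + n.2, n.1 - n.2)) fun n : ℤ × ℤ => (n.1 + n.2 + 1, n.1 - n.2)) := by
  constructor
  · rintro (⟨a, b⟩ | ⟨a, b⟩) (⟨c, d⟩ | ⟨c, d⟩) hab <;>
      simp only [Sum.elim_inl, Sum.elim_inr, Prod.mk.injEq] at hab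
    · rw [show a = c by lia, show b = d by lia]
    · lia
    · lia
    · rw [show a = c by lia, show b = d by lia]
  · rintro ⟨a, b⟩
    obtain ⟨c, hc | hc⟩ := Int.even_or_odd' (a + b)
    · exact ⟨Sum.inl (c, a - c), by simp; lia⟩
    · exact ⟨Sum.inr (c, a - c - 1), by simp; lia⟩

/-- The substitution (m + n, m - n) diagonalises the sum of two squares; the two terms are the
parity classes of the index sum. -/
lemma thetaSum_mul_thetaSum {h : ℂ} (hh : h.re < 0) (a b : ℂ) :
    thetaSum h a * thetaSum h b =
      thetaSum (2 * h) ((a + b) / 2) * thetaSum (2 * h) ((a - b) / 2) +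
      nome h (1 + a) * (thetaSum (2 * h) ((a + b) / 2 + 1) * thetaSum (2 * h) ((a - b) / 2 + 1)) := by
  have h2 : (2 * h).re < 0 := by simp; linarith
  have h1 := hasSum_of_bijective_sumElim bijective_parity_add
    (f := fun n : ℤ × ℤ => nome h (n.1 ^ 2 + a * n.1) * nome h (n.2 ^ 2 + b * n.2))
    (((hasSum_thetaSum h2 ((a + b) / 2)).mul_complex
      (hasSum_thetaSum h2 ((a - b) / 2))).congr_fun fun n => ?_)
    ((((hasSum_thetaSum h2 ((a + b) / 2 + 1)).mul_complex
      (hasSum_thetaSum h2 ((a - b) / 2 + 1))).mul_left (nome h (1 + a))).congr_fun fun n => ?_)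
  · exact ((hasSum_thetaSum hh a).mul_complex (hasSum_thetaSum hh b)).unique h1
  · simp only [nome_mul, ← nome_add]
    congr 1
    push_cast
    ring
  · simp only [nome_mul, ← nome_add]
    congr 1
    push_cast
    ring

/-- With d = 2b and N = a + b the form becomes a² + 3b²; odd d gives the second term. -/
lemma hexSum_eq {h : ℂ} (hh : h.re < 0) (s t : ℂ) :
    hexSum h s t = thetaSum h s * thetaSum (3 * h) ((s + 2 * t) / 3) +
      nome h (1 + t) * (thetaSum h (s - 1) * thetaSum (3 * h) ((s + 2 * t) / 3 + 1)) := by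
  have h3 : (3 * h).re < 0 := by simp; linarith
  refine (hasSum_of_bijective_sumElim bijective_parity_snd
    (((hasSum_thetaSum hh s).mul_complex
      (hasSum_thetaSum h3 ((s + 2 * t) / 3))).congr_fun fun n => ?_)
    ((((hasSum_thetaSum hh (s - 1)).mul_complex
      (hasSum_thetaSum h3 ((s + 2 * t) / 3 + 1))).mul_left
        (nome h (1 + t))).congr_fun fun n => ?_)).tsum_eq
  · simp only [nome_mul, ← nome_add]
    congr 1
    push_cast
    ring
  · simp only [nome_mul, ← nome_add]
    congr 1
    push_cast
    ring

/-! ### The cubic theta function -/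

/-- The rotation of order three about the minimum of `N² - N d + d² + N`. -/
def hexRotation : ℤ × ℤ ≃ ℤ × ℤ where
  toFun n := (-n.2 - 1, n.1 - n.2)
  invFun n := (n.2 - n.1 - 1, -n.1 - 1)
  left_inv n := by simp only [Prod.ext_iff]; lia
  right_inv n := by ext <;> simp

/-- The rotation preserves the summand, and the first coordinates along an orbit of three add up to
-2, so N has mean -2/3. -/
lemma tsum_fst_mul_hex {h : ℂ} (hh : h.re < 0) :
    ∑' n : ℤ × ℤ, (n.1 : ℂ) * nome h (n.1 ^ 2 - n.1 * n.2 + n.2 ^ 2 + 1 * n.1 + 0 * n.2) =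
      -(2 / 3) * hexSum h 1 0 := by
  set g : ℤ × ℤ → ℂ := fun n => nome h (n.1 ^ 2 - n.1 * n.2 + n.2 ^ 2 + 1 * n.1 + 0 * n.2) with hg
  have hs : Summable fun n : ℤ × ℤ => (n.1 : ℂ) * g n := summable_fst_mul_hex hh 1 0
  have hs' : Summable g := summable_hex hh 1 0
  have e0 : ∀ n, g (hexRotation n) = g n := fun n => by
    simp only [hg, hexRotation, Equiv.coe_fn_mk]; push_cast; ring_nf
  have e1 := hexRotation.tsum_eq fun n : ℤ × ℤ => (n.1 : ℂ) * g n
  have s1 := hexRotation.summable_iff.mpr hs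
  have e2 := (hexRotation.trans hexRotation).tsum_eq fun n : ℤ × ℤ => (n.1 : ℂ) * g n
  have s2 := (hexRotation.trans hexRotation).summable_iff.mpr hs
  have e3 : ∑' n, (-2) * g n = _ := (tsum_congr fun n => ?_).trans ((hs.add s1).tsum_add s2)
  · rw [hs.tsum_add s1, tsum_mul_left] at e3
    simp only [Function.comp_def] at e3
    rw [e1, e2] at e3
    change _ = -(2 / 3) * ∑' n, g n
    linear_combination -e3 / 3
  · simp only [Function.comp, Equiv.trans_apply, e0]
    simp only [hexRotation, Equiv.coe_fn_mk]
    push_cast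
    ring

/-- The twist is q^(κ(2N-d)), with q^κ a nontrivial cube root of unity. The rotation raises 2N - d
by 1 modulo 3, so the sum equals q^κ times itself. -/
lemma hexSum_eq_zero {h κ : ℂ} (hκ : nome h (3 * κ) = 1) (hκ' : nome h κ ≠ 1) :
    hexSum h (1 + 2 * κ) (-κ) = 0 := by
  have e : hexSum h (1 + 2 * κ) (-κ) = nome h κ * hexSum h (1 + 2 * κ) (-κ) := by
    nth_rw 1 [hexSum]
    rw [hexSum, ← tsum_mul_left, ← hexRotation.tsum_eq]
    refine tsum_congr fun n => ?_
    have e1 : nome h (3 * κ * (-n.1 - 1 : ℤ)) = 1 := by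
      rw [mul_comm, ← nome_zpow, hκ, one_zpow]
    refine Eq.trans ?_ ((congrArg (_ * ·) e1).trans (mul_one _))
    simp only [← nome_add]
    simp only [hexRotation, Equiv.coe_fn_mk]
    congr 1
    push_cast
    ring
  have : (1 - nome h κ) * hexSum h (1 + 2 * κ) (-κ) = 0 := by linear_combination e
  exact (mul_eq_zero.mp this).resolve_left (sub_ne_zero.mpr hκ'.symm)

lemma qPochInf_trisect {q : ℂ} (hq : ‖q‖ < 1) (a : ℂ) :
    qPochInf a (q ^ 3) * qPochInf (a * q) (q ^ 3) * qPochInf (a * q ^ 2) (q ^ 3) = qPochInf a q := by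
  have h3 := norm_cube_lt_one hq
  have h1 := ((tendsto_qPoch h3 a).mul (tendsto_qPoch h3 (a * q))).mul (tendsto_qPoch h3 (a * q ^ 2))
  have h2 := (tendsto_qPoch hq a).comp
    (Filter.tendsto_id.const_mul_atTop' (show 0 < 3 by norm_num) :
      Filter.Tendsto (fun n : ℕ => 3 * n) _ _)
  refine tendsto_nhds_unique (h1.congr fun n => ?_) h2
  simp only [Function.comp, qPoch]
  induction n with
  | zero => simp
  | succ n ih =>
    rw [Nat.mul_succ, prod_range_succ, prod_range_succ, prod_range_succ, prod_range_succ,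
      prod_range_succ, prod_range_succ, ← ih]
    ring

/-- The product `(q ^ m; q ^ m)_∞` for `q = exp h`. -/
noncomputable def eulerProd (h m : ℂ) : ℂ := qPochInf (nome h m) (nome h m)

lemma eulerProd_ne_zero {h : ℂ} (hh : h.re < 0) {m : ℝ} (hm : 0 < m) : eulerProd h m ≠ 0 :=
  qPochInf_self_ne_zero (norm_nome_lt_one hh hm)

lemma qPochInf_neg_mul_eulerProd {h : ℂ} (hh : h.re < 0) {m : ℝ} (hm : 0 < m) :
    qPochInf (-nome h m) (nome h m) * eulerProd h m = eulerProd h (2 * m) := by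
  rw [eulerProd, mul_comm, qPochInf_mul_neg (norm_nome_lt_one hh hm), nome_pow, eulerProd]
  norm_cast

lemma half_re_neg {h : ℂ} (hh : h.re < 0) : (h / 2).re < 0 := by
  rw [show h / 2 = ((1 / 2 : ℝ) : ℂ) * h by push_cast; ring, Complex.re_ofReal_mul]; linarith

lemma exists_nome_eq {h : ℂ} (hh : h.re < 0) {z : ℂ} (hz : z ≠ 0) : ∃ s, nome h s = z := by
  have h0 : h ≠ 0 := by rintro rfl; simp at hh
  exact ⟨Complex.log z / h, by rw [nome, mul_div_cancel₀ _ h0, Complex.exp_log hz]⟩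

lemma exists_cubic_root : ∃ w : ℂ, 1 + w + w ^ 2 = 0 := by
  obtain ⟨z, hz⟩ := IsAlgClosed.exists_pow_nat_eq (-3 : ℂ) two_pos
  exact ⟨(-1 + z) / 2, by linear_combination hz / 4⟩

lemma nome_half (h s : ℂ) : nome (h / 2) s = nome h (s / 2) := by
  rw [nome, nome]; ring_nf

/-- The product of the theta series at `a` and `b`, where `-q ^ ((1 + a) / 2) = w` and
`-q ^ ((1 + b) / 2) = w²`, is `3 (q³; q³)_∞²`. -/
lemma thetaSum_half_mul {h w κ μ : ℂ} (hh : h.re < 0) (hw : 1 + w + w ^ 2 = 0)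
    (hκ : nome h κ = w) (hμ : nome h μ = -1) :
    thetaSum (h / 2) (2 * μ + 2 * κ - 1) * thetaSum (h / 2) (2 * μ - 2 * κ - 1) =
      3 * eulerProd h 3 ^ 2 := by
  have h2 := half_re_neg hh
  have hq := norm_nome_one_lt hh
  have w3 : w ^ 3 = 1 := by linear_combination (w - 1) * hw
  have hκ' : nome h (-κ) = w ^ 2 := by
    have : nome h κ * nome h (-κ) = 1 := by rw [← nome_add, add_neg_cancel, nome_zero]
    rw [hκ] at this
    linear_combination w ^ 2 * this - nome h (-κ) * w3
  have hμ' : nome h (-μ) = -1 := by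
    have : nome h μ * nome h (-μ) = 1 := by rw [← nome_add, add_neg_cancel, nome_zero]
    rw [hμ] at this
    linear_combination -this
  rw [thetaSum_eq h2, thetaSum_eq h2]
  simp only [nome_half]
  have e1 : -nome h ((1 + (2 * μ + 2 * κ - 1)) / 2) = w := by
    rw [show (1 + (2 * μ + 2 * κ - 1)) / 2 = μ + κ by ring, nome_add, hμ, hκ]; ring
  have e2 : -nome h ((1 - (2 * μ + 2 * κ - 1)) / 2) = w ^ 2 * nome h 1 := by
    rw [show (1 - (2 * μ + 2 * κ - 1)) / 2 = 1 + (-μ + -κ) by ring, nome_add, nome_add, hμ', hκ']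
    ring
  have e3 : -nome h ((1 + (2 * μ - 2 * κ - 1)) / 2) = w ^ 2 := by
    rw [show (1 + (2 * μ - 2 * κ - 1)) / 2 = μ + -κ by ring, nome_add, hμ, hκ']; ring
  have e4 : -nome h ((1 - (2 * μ - 2 * κ - 1)) / 2) = w * nome h 1 := by
    rw [show (1 - (2 * μ - 2 * κ - 1)) / 2 = 1 + (-μ + κ) by ring, nome_add, nome_add, hμ', hκ]
    ring
  rw [e1, e2, e3, e4, div_self two_ne_zero, qPochInf_eq_one_sub_mul hq w,
    qPochInf_eq_one_sub_mul hq (w ^ 2)]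
  have e5 := qPochInf_mul_cubic hq hw (nome h 1)
  rw [show nome h 1 ^ 3 = nome h 3 by rw [nome_pow]; norm_num] at e5
  have e6 : (1 - w) * (1 - w ^ 2) = 3 := by linear_combination w3 - hw
  rw [eulerProd, ← e5]
  linear_combination (qPochInf (nome h 1) (nome h 1) * (qPochInf (w * nome h 1) (nome h 1)
    * qPochInf (w ^ 2 * nome h 1) (nome h 1))) ^ 2 * e6

theorem hexSum_one_mul {h : ℂ} (hh : h.re < 0) :
    hexSum h 1 0 * eulerProd h 1 = 3 * eulerProd h 3 ^ 3 := by
  obtain ⟨w, hw⟩ := exists_cubic_root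
  have w3 : w ^ 3 = 1 := by linear_combination (w - 1) * hw
  have w0 : w ≠ 0 := by rintro rfl; simp at w3
  have w1 : w ≠ 1 := by rintro rfl; norm_num at hw
  obtain ⟨κ, hκ⟩ := exists_nome_eq hh w0
  obtain ⟨μ, hμ⟩ := exists_nome_eq hh (show (-1 : ℂ) ≠ 0 by norm_num)
  have h2 := half_re_neg hh
  have h3 : (3 * h).re < 0 := by simp; linarith
  have hq := norm_nome_one_lt hh
  have hκ' : nome h (-κ) = w ^ 2 := by
    have : nome h κ * nome h (-κ) = 1 := by rw [← nome_add, add_neg_cancel, nome_zero]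
    rw [hκ] at this
    linear_combination w ^ 2 * this - nome h (-κ) * w3
  have p : ∀ (s : ℂ) (n : ℕ), nome h (n * s) = nome h s ^ n := fun s n => (nome_pow h s n).symm
  have hμ2 : nome h (2 * μ) = 1 := by have := p μ 2; rw [hμ] at this; simpa using this
  -- the zero of the twisted hexagonal series
  have z := hexSum_eq_zero (h := h) (κ := κ)
    (by have := p κ 3; rw [hκ, w3] at this; simpa using this) (hκ ▸ w1)
  rw [hexSum_eq hh, show (1 + 2 * κ + 2 * -κ) / 3 = 1 / 3 by ring,
    show 1 + 2 * κ - 1 = 2 * κ by ring, nome_add, hκ'] at z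
  have c := hexSum_eq hh 1 0
  rw [mul_zero, add_zero, sub_self] at c
  -- the product of two theta series
  have t := thetaSum_mul_thetaSum h2 (2 * μ + 2 * κ - 1) (2 * μ - 2 * κ - 1)
  rw [thetaSum_half_mul hh hw hκ hμ, mul_div_cancel₀ _ (two_ne_zero (α := ℂ)),
    show (2 * μ + 2 * κ - 1 + (2 * μ - 2 * κ - 1)) / 2 = -1 + 2 * μ by ring,
    show (2 * μ + 2 * κ - 1 - (2 * μ - 2 * κ - 1)) / 2 = 2 * κ by ring,
    thetaSum_congr (show nome h (-1 + 2 * μ) = nome h (-1) by rw [nome_add, hμ2, mul_one]),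
    thetaSum_congr (show nome h (-1 + 2 * μ + 1) = nome h 0 by
      rw [show -1 + 2 * μ + 1 = 2 * μ by ring, hμ2, nome_zero]),
    thetaSum_neg, nome_half, show (1 + (2 * μ + 2 * κ - 1)) / 2 = μ + κ by ring, nome_add, hμ, hκ,
    add_comm (2 * κ)] at t
  -- The vanishing twisted series eliminates the theta value at 1/3 + 1 from the expansion of
  -- `hexSum h 1 0`; what remains is the theta product in `t`.
  have pc : thetaSum h (2 * κ) * hexSum h 1 0 =
      thetaSum (3 * h) (1 / 3) * (3 * eulerProd h 3 ^ 2) := by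
    rw [t, c]
    linear_combination w * thetaSum h 0 * z
      - nome h 1 * thetaSum (3 * h) (1 / 3 + 1) * thetaSum h (2 * κ) * thetaSum h 0 * w3
  -- the remaining theta series as products
  have q2 : nome h 2 = nome h 1 ^ 2 := by rw [nome_pow]; norm_num
  have q3 : nome h 3 = nome h 1 ^ 3 := by rw [nome_pow]; norm_num
  have q4 : nome h 4 = nome h 1 ^ 4 := by rw [nome_pow]; norm_num
  have q6 : nome h 6 = nome h 1 ^ 6 := by rw [nome_pow]; norm_num
  have P : thetaSum h (2 * κ) = qPochInf (w ^ 2 * -nome h 1) (nome h 1 ^ 2) *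
      qPochInf (w * -nome h 1) (nome h 1 ^ 2) * eulerProd h 2 := by
    have e1 : nome h (2 * κ) = w ^ 2 := by have := p κ 2; rw [hκ] at this; simpa using this
    have e2 : nome h (-(2 * κ)) = w := by
      rw [show -(2 * κ) = -κ + -κ by ring, nome_add, hκ']; linear_combination w * w3
    rw [thetaSum_eq hh, nome_add, sub_eq_add_neg, nome_add, e1, e2, eulerProd, q2, mul_neg, mul_neg,
      mul_comm w, mul_comm (w ^ 2)]
  have A : thetaSum (3 * h) (1 / 3) = qPochInf (-nome h 1 ^ 4) (nome h 1 ^ 6) *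
      qPochInf (-nome h 1 ^ 2) (nome h 1 ^ 6) * eulerProd h 6 := by
    rw [thetaSum_eq h3, nome_mul, nome_mul, nome_mul, eulerProd, ← q4, ← q6, ← q2]
    norm_num
  have c1 := qPochInf_mul_cubic (norm_sq_lt_one hq) hw (-nome h 1)
  have c2 := qPochInf_trisect (norm_sq_lt_one hq) (-nome h 1 ^ 2)
  have c3 := qPochInf_even_mul_odd hq (-nome h 1)
  have c4 := qPochInf_even_mul_odd (norm_cube_lt_one hq) (-nome h 1 ^ 3)
  have c5 := qPochInf_neg_mul_eulerProd hh one_pos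
  have c6 := qPochInf_neg_mul_eulerProd hh three_pos
  have n2 : eulerProd h 2 ≠ 0 := by simpa using eulerProd_ne_zero hh two_pos
  have n6 : eulerProd h 6 ≠ 0 := by simpa using eulerProd_ne_zero hh (show (0 : ℝ) < 6 by norm_num)
  norm_num at c5 c6
  rw [q3] at c6
  rw [show (-nome h 1) ^ 3 = -nome h 1 ^ 3 by ring, ← pow_mul] at c1
  rw [show -nome h 1 ^ 2 * nome h 1 ^ 2 = -nome h 1 ^ 4 by ring,
    show -nome h 1 ^ 2 * (nome h 1 ^ 2) ^ 2 = -nome h 1 ^ 6 by ring, ← pow_mul] at c2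
  rw [show -nome h 1 * nome h 1 = -nome h 1 ^ 2 by ring] at c3
  rw [show -nome h 1 ^ 3 * nome h 1 ^ 3 = -nome h 1 ^ 6 by ring, ← pow_mul] at c4
  norm_num only at c1 c2 c4
  rw [P, A] at pc
  refine mul_left_cancel₀ n2 (mul_left_cancel₀ n6 ?_)
  linear_combination -(eulerProd h 2 * hexSum h 1 0 * eulerProd h 1) * c6
    - eulerProd h 3 * eulerProd h 2 * hexSum h 1 0 * eulerProd h 1 * c4
    - qPochInf (-nome h 1 ^ 6) (nome h 1 ^ 6) * eulerProd h 3 * eulerProd h 2 * hexSum h 1 0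
      * eulerProd h 1 * c1
    + qPochInf (-nome h 1) (nome h 1 ^ 2) * qPochInf (-nome h 1 ^ 6) (nome h 1 ^ 6) * eulerProd h 3
      * eulerProd h 1 * pc
    + 3 * eulerProd h 3 ^ 3 * eulerProd h 6
      * (qPochInf (-nome h 1) (nome h 1 ^ 2) * eulerProd h 1 * c2 + eulerProd h 1 * c3 + c5)

/-! ### Special values of the ternary sums -/

theorem ternSum_one_one_neg_one {h : ℂ} (hh : h.re < 0) :
    ternSum h 1 1 (-1) = 2 * (eulerProd h 3 ^ 3 / (eulerProd h 1 * eulerProd h 2 ^ 2)) := by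
  have n1 : eulerProd h 1 ≠ 0 := by simpa using eulerProd_ne_zero hh one_pos
  have n2 : eulerProd h 2 ≠ 0 := by simpa using eulerProd_ne_zero hh two_pos
  -- The moments at (1,1,0) and (1,1,-1) vanish by antisymmetry, so the sum at (1,1,-1) is the
  -- moment at (-1,1,0).
  have e := tsum_sub_mul_ternTerm_sub_fst hh (-1) 1 0
  norm_num [tsum_sub_mul_ternTerm_self] at e
  rw [← e, tsum_sub_mul_ternTerm_neg_self hh, tsum_fst_mul_hex hh, ← eulerProd]
  have := hexSum_one_mul hh
  field_simp
  linear_combination this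

lemma ternSum_neg_one_one_zero {h : ℂ} (hh : h.re < 0) :
    ternSum h (-1) 1 0 = 3 * (eulerProd h 3 ^ 3 / (eulerProd h 1 * eulerProd h 2 ^ 2)) := by
  have n1 : eulerProd h 1 ≠ 0 := by simpa using eulerProd_ne_zero hh one_pos
  have n2 : eulerProd h 2 ≠ 0 := by simpa using eulerProd_ne_zero hh two_pos
  rw [ternSum_neg_self hh, ← eulerProd]
  have := hexSum_one_mul hh
  field_simp
  linear_combination this

theorem ternSum_one_one_zero {h : ℂ} (hh : h.re < 0) :
    ternSum h 1 1 0 = eulerProd h 3 ^ 3 / (eulerProd h 1 * eulerProd h 2 ^ 2) := by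
  have e := ternSum_sub_fst hh (-1) 1 0
  norm_num at e
  rw [ternSum_one_one_neg_one hh, ternSum_neg_one_one_zero hh] at e
  linear_combination -e

/-- The relation between `∑` at `(u, -u, 1)` and at `(u + 1, -u - 1, 1)`. -/
lemma ternSum_add_ternSum_succ {h : ℂ} (hh : h.re < 0) (u : ℂ) :
    ternSum h u (-u) 1 + ternSum h (u + 1) (-(u + 1)) 1 =
      nome h (-u) * ternSum h (u - 1) (-(u - 1)) 0 := by
  -- These three relations share the sums at (1+u, 1-u, c) for c = -1, 0, 1, which all cancel.
  have e1 := ternSum_sub_thd hh (1 + u) (1 - u) (-1)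
  have e2 := ternSum_sub_fst hh (u - 1) (1 - u) 0
  have e3 := ternSum_sub_snd hh (1 + u) (-1 - u) 1
  have e4 : nome h (-u) * nome h u = 1 := by rw [← nome_add, neg_add_cancel, nome_zero]
  rw [show (-1 : ℂ) + 1 = 0 by ring, nome_zero, one_mul, show (-1 : ℂ) + 2 = 1 by ring,
    show 1 + u - 1 = u by ring, show 1 - u - 1 = -u by ring] at e1
  rw [show u - 1 + 2 = 1 + u by ring, show u - 1 + 1 = u by ring, zero_sub] at e2
  rw [show -1 - u + 2 = 1 - u by ring, show -1 - u + 1 = -u by ring, sub_self] at e3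
  rw [show u + 1 = 1 + u by ring, show -(1 + u) = -1 - u by ring, show -(u - 1) = 1 - u by ring]
  linear_combination -e1 + e3 - nome h (-u) * e2 - ternSum h (1 + u) (1 - u) (-1) * e4

theorem ternSum_zero_zero_neg_one {h : ℂ} (hh : h.re < 0) :
    ternSum h 0 0 (-1) = 6 * (eulerProd h 3 ^ 3 / (eulerProd h 1 * eulerProd h 2 ^ 2)) := by
  have e1 := ternSum_add_ternSum_succ hh 0
  have e2 := ternSum_sub_thd hh 0 0 (-1)
  have e3 := ternSum_sub_fst hh (-1) (-1) 1
  have e4 := ternSum_swap h (-1) 1 0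
  norm_num at e1 e2 e3
  rw [ternSum_neg_one_one_zero hh] at e1 e4
  linear_combination e2 + e3 + e1 - e4

/-- With x = q^(1/2) this is Gauss's ∑ x^(2n²+n) = (x²;x²)_∞² / (x;x)_∞. -/
lemma thetaSum_half_mul_eulerProd {h : ℂ} (hh : h.re < 0) :
    thetaSum h (1 / 2) * eulerProd h (1 / 2) = eulerProd h 1 ^ 2 := by
  have hq : ‖nome h (1 / 2)‖ < 1 := by
    simpa using norm_nome_lt_one hh (show (0 : ℝ) < 1 / 2 by norm_num)
  have q2 : nome h 1 = nome h (1 / 2) ^ 2 := by rw [nome_pow]; norm_num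
  have q3 : nome h (3 / 2) = nome h (1 / 2) ^ 3 := by rw [nome_pow]; norm_num
  have q4 : nome h 2 = nome h (1 / 2) ^ 4 := by rw [nome_pow]; norm_num
  have T := thetaSum_eq hh (1 / 2)
  have c1 := qPochInf_even_mul_odd (norm_sq_lt_one hq) (-nome h (1 / 2))
  have c2 := qPochInf_even_mul_odd hq (nome h (1 / 2))
  have c3 := qPochInf_mul_neg (norm_sq_lt_one hq) (nome h (1 / 2))
  have c4 := qPochInf_even_mul_odd (norm_sq_lt_one hq) (nome h (1 / 2) ^ 2)
  rw [show (1 : ℂ) + 1 / 2 = 3 / 2 by norm_num, show (1 : ℂ) - 1 / 2 = 1 / 2 by norm_num, q3,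
    q4] at T
  rw [← pow_mul, show -nome h (1 / 2) * nome h (1 / 2) ^ 2 = -nome h (1 / 2) ^ 3 by ring] at c1
  rw [← pow_two] at c2
  rw [← pow_mul] at c3
  rw [← pow_mul, ← pow_add] at c4
  norm_num only at c1 c3 c4 T
  rw [eulerProd, eulerProd, q2, T]
  generalize nome h (1 / 2) = q at *
  linear_combination qPochInf (q ^ 4) (q ^ 4) * qPochInf q q * c1
    - qPochInf (q ^ 4) (q ^ 4) * qPochInf (-q) (q ^ 2) * c2
    + qPochInf (q ^ 4) (q ^ 4) * qPochInf (q ^ 2) (q ^ 2) * c3 + qPochInf (q ^ 2) (q ^ 2) * c4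

theorem ternSum_half_neg_half_one {h : ℂ} (hh : h.re < 0) :
    ternSum h (1 / 2) (-1 / 2) 1 = eulerProd h 1 ^ 2 * eulerProd h 3 ^ 2 /
      (eulerProd h (1 / 2) * eulerProd h (3 / 2) * eulerProd h 2 ^ 2) := by
  have h3 : (3 * h).re < 0 := by simp; linarith
  have n1 : eulerProd h (1 / 2) ≠ 0 := by
    simpa using eulerProd_ne_zero hh (show (0 : ℝ) < 1 / 2 by norm_num)
  have n3 : eulerProd h (3 / 2) ≠ 0 := by
    simpa using eulerProd_ne_zero hh (show (0 : ℝ) < 3 / 2 by norm_num)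
  have n2 : eulerProd h 2 ≠ 0 := by simpa using eulerProd_ne_zero hh two_pos
  -- At u = -1/2 the two sums on the left are exchanged by i ↔ j, hence equal; likewise both terms
  -- of the split hexagonal series turn out equal.
  have e1 := ternSum_add_ternSum_succ hh (-1 / 2)
  rw [show -(-1 / 2 : ℂ) = 1 / 2 by norm_num, show (-1 / 2 : ℂ) + 1 = 1 / 2 by norm_num,
    show -(1 / 2 : ℂ) = -1 / 2 by norm_num, show (-1 / 2 : ℂ) - 1 = -(3 / 2) by norm_num,
    neg_neg, ternSum_neg_self hh, ← eulerProd] at e1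
  have e2 := ternSum_swap h (-1 / 2) (1 / 2) 1
  have e4 := hexSum_eq hh (3 / 2) 0
  rw [show (3 / 2 + 2 * 0) / 3 = (1 / 2 : ℂ) by norm_num, add_zero,
    show (3 / 2 : ℂ) - 1 = 1 / 2 by norm_num, show (1 / 2 : ℂ) + 1 = 3 / 2 by norm_num] at e4
  have shift : ∀ k : ℂ, thetaSum k (3 / 2) = nome k (-1 / 2) * thetaSum k (1 / 2) := fun k => by
    rw [← thetaSum_neg k (1 / 2), show (3 / 2 : ℂ) = -(1 / 2) + 2 by norm_num, thetaSum_add_two]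
    norm_num
  have p1 := thetaSum_half_mul_eulerProd hh
  have p3 := thetaSum_half_mul_eulerProd h3
  have m1 : eulerProd (3 * h) (1 / 2) = eulerProd h (3 / 2) := by
    rw [eulerProd, nome_mul, eulerProd]; norm_num
  have m2 : eulerProd (3 * h) 1 = eulerProd h 3 := by rw [eulerProd, nome_mul, eulerProd]; norm_num
  rw [m1, m2] at p3
  have k1 : nome h (1 / 2) * nome h (-1 / 2) = 1 := by rw [← nome_add]; norm_num
  have k2 : nome h (1 / 2) * (nome h 1 * nome (3 * h) (-1 / 2)) = 1 := by
    rw [nome_mul, ← nome_add, ← nome_add]; norm_num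
  rw [shift, shift] at e4
  have e5 : ternSum h (1 / 2) (-1 / 2) 1 * eulerProd h 2 ^ 2 =
      thetaSum h (1 / 2) * thetaSum (3 * h) (1 / 2) := by
    rw [e2, e4] at e1
    field_simp at e1
    rw [show -(1 / 2 : ℂ) = -1 / 2 by norm_num] at e1
    linear_combination e1 / 2 + thetaSum h (1 / 2) * thetaSum (3 * h) (1 / 2) / 2 * (k1 + k2)
  rw [← p1, ← p3, eq_div_iff (mul_ne_zero (mul_ne_zero n1 n3) (pow_ne_zero 2 n2))]
  linear_combination eulerProd h (1 / 2) * eulerProd h (3 / 2) * e5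

/-! ### The first family -/

/-- Extracting k factors gives (-q^(-k);q)_∞ = q^(-k(k+1)/2) (-q;q)_k (-1;q)_∞, and (-q;q)_k cancels
in (q²;q²)_k = (q;q)_k (-q;q)_k. -/
lemma qPochInf_neg_nome_mul_qInv {h : ℂ} (hh : h.re < 0) (k : ℕ) :
    qPochInf (-nome h (-k)) (nome h 1) * qInv (nome h 2) k * nome h (k * (k + 1) / 2) =
      qPochInf (-1) (nome h 1) * qInv (nome h 1) k := by
  induction k with
  | zero => simp
  | succ k ih =>
    have hne : 1 - nome h 1 ^ (k + 1) ≠ 0 := by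
      rw [pow_succ']; exact one_sub_pow_ne_zero (norm_nome_one_lt hh) k
    have e1 := one_sub_mul_qInv (norm_nome_one_lt hh) (k + 1 : ℤ)
    have e2 := one_sub_mul_qInv (norm_nome_two_lt hh) (k + 1 : ℤ)
    rw [add_sub_cancel_right] at e1 e2
    have e3 := qPochInf_eq_one_sub_mul (norm_nome_one_lt hh) (-nome h (-(k + 1)))
    rw [neg_mul, ← nome_add, show -((k : ℂ) + 1) + 1 = -k by ring] at e3
    have e4 : nome h (-(k + 1)) * nome h 1 ^ (k + 1) = 1 := by
      rw [nome_pow, ← nome_add]; push_cast; ring_nf; simp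
    have e5 : nome h ((k + 1) * (k + 1 + 1) / 2) =
        nome h (k * (k + 1) / 2) * nome h 1 ^ (k + 1) := by
      rw [nome_pow, ← nome_add]; push_cast; ring_nf
    have e6 : nome h 2 ^ (k + 1) = (nome h 1 ^ (k + 1)) ^ 2 := by
      rw [nome_pow, nome_pow, nome_pow]; push_cast; ring_nf
    have z : ∀ x : ℂ, x ^ ((k : ℤ) + 1) = x ^ (k + 1) := fun x => by
      rw [← zpow_natCast]; push_cast; rfl
    rw [z] at e1 e2
    rw [e6] at e2
    push_cast
    rw [e3, e5]
    refine mul_left_cancel₀ hne ?_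
    generalize nome h 1 ^ (k + 1) = y at *
    generalize nome h (-(k + 1)) = x at *
    generalize qPochInf (-nome h (-k)) (nome h 1) = A at *
    linear_combination (1 - y) * A * qInv (nome h 2) (k + 1) * nome h (k * (k + 1) / 2) * e4
      + A * nome h (k * (k + 1) / 2) * e2 + ih - qPochInf (-1) (nome h 1) * e1

/-- The indices `(i, j, k)` in terms of `(k, i, j)`. -/
def rotEquiv : ℤ × ℤ × ℤ ≃ ℤ × ℤ × ℤ where
  toFun n := (n.2.1, n.2.2, n.1)
  invFun n := (n.2.2, n.1, n.2.1)
  left_inv _ := rfl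
  right_inv _ := rfl

theorem ternSum_zero_neg_one {h : ℂ} (hh : h.re < 0) (c : ℂ) :
    ternSum h 0 (-1) c =
      qPochInf (-1) (nome h 1) * qPochInf (-nome h c) (nome h 1) := by
  -- The remaining sum over k has denominator (q;q)_k, hence Euler's identity with h / 2.
  have hE := (hasSum_euler (half_re_neg hh) (2 * c - 1)).mul_left (qPochInf (-1) (nome h 1))
  simp only [nome_half] at hE
  rw [show (2 * c - 1 + 1) / 2 = c by ring, div_self two_ne_zero] at hE
  refine ((rotEquiv.hasSum_iff.mpr (summable_ternTerm hh 0 (-1) c).hasSum).prod_fiberwise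
    (g := fun k : ℤ => qPochInf (-1) (nome h 1) * (nome h ((k ^ 2 + (2 * c - 1) * k) / 2) *
      qInv (nome h 1) k)) fun k => ?_).unique hE
  rcases lt_or_ge k 0 with hk | hk
  · rw [qInv_of_neg _ hk, mul_zero, mul_zero]
    refine hasSum_zero.congr_fun fun n => ?_
    simp [ternTerm, rotEquiv, qInv_of_neg _ hk]
  · lift k to ℕ using hk
    have e1 := qPochInf_neg_nome_mul_qInv hh k
    have e2 := qPochInf_even_mul_odd (norm_nome_one_lt hh) (-nome h (-k))
    rw [nome_pow, neg_mul, ← nome_add] at e2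
    norm_num at e2
    have e3 := ((hasSum_euler hh (-k)).mul_complex (hasSum_euler hh (-1 - k))).mul_left
      (nome h (k ^ 2 + c * k) * qInv (nome h 2) k)
    rw [show (-1 - k + 1 : ℂ) = -k by ring] at e3
    have e4 : nome h (k ^ 2 + c * k) =
        nome h (((k : ℤ) ^ 2 + (2 * c - 1) * (k : ℤ)) / 2) * nome h (k * (k + 1) / 2) := by
      rw [← nome_add]; push_cast; ring_nf
    have e5 : nome h (k ^ 2 + c * k) * qInv (nome h 2) k *
        (qPochInf (-nome h (-k + 1)) (nome h 2) * qPochInf (-nome h (-k)) (nome h 2)) =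
        qPochInf (-1) (nome h 1) * (nome h (((k : ℤ) ^ 2 + (2 * c - 1) * (k : ℤ)) / 2) *
          qInv (nome h 1) k) := by
      rw [e4, mul_comm (qPochInf (-nome h (-k + 1)) _), e2]
      linear_combination nome h (((k : ℤ) ^ 2 + (2 * c - 1) * (k : ℤ)) / 2) * e1
    rw [← e5]
    refine e3.congr_fun fun n => ?_
    simp only [Function.comp, ternTerm, rotEquiv, Equiv.coe_fn_mk]
    have e6 : nome h ((n.1 : ℂ) ^ 2 + (n.2 : ℂ) ^ 2 + ((k : ℤ) : ℂ) ^ 2 - n.1 * ((k : ℤ) : ℂ)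
        - n.2 * ((k : ℤ) : ℂ) + 0 * n.1 + -1 * n.2 + c * ((k : ℤ) : ℂ)) =
        nome h (k ^ 2 + c * k) * (nome h (n.1 ^ 2 + -k * n.1) * nome h (n.2 ^ 2 + (-1 - k) * n.2)) := by
      rw [← nome_add, ← nome_add]; push_cast; ring_nf
    rw [e6]
    ring

/-! ### The sums over natural numbers -/

/-- The logarithm of the nome `q = exp (2 π i τ)`. -/
noncomputable def logNome (τ : UpperHalfPlane) : ℂ := 2 * (Real.pi : ℂ) * Complex.I * (τ : ℂ)

lemma logNome_re (τ : UpperHalfPlane) : (logNome τ).re < 0 := by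
  have : logNome τ = ((2 * Real.pi : ℝ) : ℂ) * (Complex.I * (τ : ℂ)) := by
    rw [logNome]; push_cast; ring
  rw [this, Complex.re_ofReal_mul, Complex.I_mul_re]
  rw [UpperHalfPlane.coe_im]
  nlinarith [mul_pos Real.pi_pos τ.im_pos]

lemma two_mul_logNome_re (τ : UpperHalfPlane) : (2 * logNome τ).re < 0 := by
  have := logNome_re τ
  simp; linarith

lemma qpow_eq (τ : UpperHalfPlane) (s : ℂ) : qpow τ s = nome (logNome τ) s := rfl

lemma qJ_eq (τ : UpperHalfPlane) (m : ℕ) : qJ τ m = eulerProd (logNome τ) m := rfl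

lemma eulerProd_two_mul (h m : ℂ) : eulerProd (2 * h) m = eulerProd h (2 * m) := by
  rw [eulerProd, nome_mul, eulerProd]

lemma hasSum_nahmTerm {h : ℂ} (hh : h.re < 0) {τ : UpperHalfPlane} {m : ℕ}
    (hm : qpow τ m = nome h 2) {a b c : ℂ} {e : ℂ → ℂ → ℂ → ℂ}
    (he : ∀ i j k, qpow τ (e i j k) =
      nome h (i ^ 2 + j ^ 2 + k ^ 2 - i * k - j * k + a * i + b * j + c * k)) :
    HasSum (nahmTerm τ m e) (ternSum h a b c) := by
  let φ : ℕ × ℕ × ℕ → ℤ × ℤ × ℤ := fun n => (n.1, n.2.1, n.2.2)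
  have hφ : Function.Injective φ := by
    rintro ⟨a, b, c⟩ ⟨a', b', c'⟩ hab
    simpa [φ] using hab
  refine ((hφ.hasSum_iff fun n hn => ?_).mpr (summable_ternTerm hh a b c).hasSum).congr_fun
    fun n => ?_
  · by_contra hne
    refine hn ⟨(n.1.toNat, n.2.1.toNat, n.2.2.toNat), ?_⟩
    have h1 : 0 ≤ n.1 := by
      by_contra hlt; exact hne (by simp [ternTerm, qInv_of_neg _ (not_le.mp hlt)])
    have h2 : 0 ≤ n.2.1 := by
      by_contra hlt; exact hne (by simp [ternTerm, qInv_of_neg _ (not_le.mp hlt)])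
    have h3 : 0 ≤ n.2.2 := by
      by_contra hlt; exact hne (by simp [ternTerm, qInv_of_neg _ (not_le.mp hlt)])
    simp [φ, Int.toNat_of_nonneg h1, Int.toNat_of_nonneg h2, Int.toNat_of_nonneg h3]
  · simp only [nahmTerm, Function.comp, φ, ternTerm, qInv_natCast, he, hm, Int.cast_natCast,
      div_eq_mul_inv, mul_inv]

lemma qJbar_eq (τ : UpperHalfPlane) (h s b : ℂ) (m : ℕ) (hh : h.re < 0)
    (h1 : nome h 2 = qpow τ m) (h2 : nome h (1 + s) = qpow τ b)
    (h3 : nome h (1 - s) = qpow τ (m - b)) : qJbar τ b m = thetaSum h s := by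
  rw [thetaSum_eq hh, h1, h2, h3, qJbar]

lemma ternSum_neg_self_eq_qJbar (τ : UpperHalfPlane) (c : ℂ) :
    ternSum (2 * logNome τ) (-(c / 2)) (c / 2) 0 = qJbar τ (2 + c) 4 * qJbar τ (6 + c) 12 / qJ τ 4 ^ 2
      + qpow τ 2 * (qJbar τ (-c) 4 * qJbar τ c 12 / qJ τ 4 ^ 2) := by
  have hh := two_mul_logNome_re τ
  have h3 : (3 * (2 * logNome τ)).re < 0 := by
    rw [show 3 * (2 * logNome τ) = ((3 : ℝ) : ℂ) * (2 * logNome τ) by push_cast; ring,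
      Complex.re_ofReal_mul]
    linarith
  have b1 : qJbar τ (2 + c) 4 = thetaSum (2 * logNome τ) (c / 2) := by
    apply qJbar_eq τ _ _ _ _ hh <;> rw [qpow_eq, nome_mul] <;> congr 1 <;> push_cast <;> ring
  have b2 : qJbar τ (6 + c) 12 = thetaSum (3 * (2 * logNome τ)) (c / 6) := by
    apply qJbar_eq τ _ _ _ _ h3 <;> rw [qpow_eq, nome_mul, nome_mul] <;> congr 1 <;> push_cast <;>
      ring
  -- The argument is written as -(x + 2) with x = c/2 - 1, so that evenness and the shift by 2 bring
  -- it to the value in the parity splitting.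
  have b3 : qJbar τ (-c) 4 = thetaSum (2 * logNome τ) (-(c / 2 - 1 + 2)) := by
    apply qJbar_eq τ _ _ _ _ hh <;> rw [qpow_eq, nome_mul] <;> congr 1 <;> push_cast <;> ring
  have b4 : qJbar τ c 12 = thetaSum (3 * (2 * logNome τ)) (c / 6 - 1) := by
    apply qJbar_eq τ _ _ _ _ h3 <;> rw [qpow_eq, nome_mul, nome_mul] <;> congr 1 <;> push_cast <;>
      ring
  have s1 := thetaSum_add_two (3 * (2 * logNome τ)) (c / 6 - 1)
  have e : nome (2 * logNome τ) 1 * nome (3 * (2 * logNome τ)) (-1 - (c / 6 - 1)) =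
      qpow τ 2 * nome (2 * logNome τ) (-1 - (c / 2 - 1)) := by
    rw [qpow_eq, nome_mul, nome_mul, nome_mul, nome_mul, ← nome_add, ← nome_add]
    ring_nf
  rw [ternSum_neg_self hh, ← eulerProd, eulerProd_two_mul, hexSum_eq hh, b1, b2, b3, b4,
    thetaSum_neg, thetaSum_add_two, qJ_eq, show (c / 2 + 2 * 0) / 3 = c / 6 by ring,
    show c / 6 + 1 = c / 6 - 1 + 2 by ring, s1, add_zero]
  norm_num
  rw [add_div]
  congr 1
  linear_combination thetaSum (2 * logNome τ) (c / 2 - 1) *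
    thetaSum (3 * (2 * logNome τ)) (c / 6 - 1) / eulerProd (logNome τ) 4 ^ 2 * e

/-- Unconditional summation in ℂ is absolute convergence, so `HasSum` covers both claims. The first
three identities use nome q², the last three q. -/
theorem theorem6p3 (τ : UpperHalfPlane) :
    (∀ a : ℂ, HasSum
      (nahmTerm τ 4 fun i j k =>
        2 * i ^ 2 + 2 * j ^ 2 + 2 * k ^ 2 - 2 * i * k - 2 * j * k - 2 * j + a * k)
      (qPochInf (-1) (qpow τ 2) * qPochInf (-qpow τ a) (qpow τ 2))) ∧
    HasSum
      (nahmTerm τ 4 fun i j k =>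
        2 * i ^ 2 + 2 * j ^ 2 + 2 * k ^ 2 - 2 * i * k - 2 * j * k + i - j + 2 * k)
      (qJ τ 2 ^ 2 * qJ τ 6 ^ 2 / (qJ τ 1 * qJ τ 3 * qJ τ 4 ^ 2)) ∧
    (∀ c : ℂ, HasSum
      (nahmTerm τ 4 fun i j k =>
        2 * i ^ 2 + 2 * j ^ 2 + 2 * k ^ 2 - 2 * i * k - 2 * j * k - c * i + c * j)
      (qJbar τ (2 + c) 4 * qJbar τ (6 + c) 12 / qJ τ 4 ^ 2
        + qpow τ 2 * (qJbar τ (-c) 4 * qJbar τ c 12 / qJ τ 4 ^ 2))) ∧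
    HasSum
      (nahmTerm τ 2 fun i j k => i ^ 2 + j ^ 2 + k ^ 2 - i * k - j * k - k)
      (6 * (qJ τ 3 ^ 3 / (qJ τ 1 * qJ τ 2 ^ 2))) ∧
    HasSum
      (nahmTerm τ 2 fun i j k => i ^ 2 + j ^ 2 + k ^ 2 - i * k - j * k + i + j - k)
      (2 * (qJ τ 3 ^ 3 / (qJ τ 1 * qJ τ 2 ^ 2))) ∧
    HasSum
      (nahmTerm τ 2 fun i j k => i ^ 2 + j ^ 2 + k ^ 2 - i * k - j * k + i + j)
      (qJ τ 3 ^ 3 / (qJ τ 1 * qJ τ 2 ^ 2)) := by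
  have hh := logNome_re τ
  have hh2 := two_mul_logNome_re τ
  have m4 : qpow τ (4 : ℕ) = nome (2 * logNome τ) 2 := by rw [qpow_eq, nome_mul]; norm_num
  have m2 : qpow τ (2 : ℕ) = nome (logNome τ) 2 := by rw [qpow_eq]; norm_num
  refine ⟨fun a => ?_, ?_, fun c => ?_, ?_, ?_, ?_⟩
  · have e := ternSum_zero_neg_one hh2 (a / 2)
    rw [nome_mul, nome_mul, mul_one, mul_div_cancel₀ _ (two_ne_zero (α := ℂ))] at e
    rw [qpow_eq, qpow_eq, ← e]
    refine hasSum_nahmTerm hh2 m4 fun i j k => ?_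
    rw [qpow_eq, nome_mul]
    ring_nf
  · have e := ternSum_half_neg_half_one hh2
    simp only [eulerProd_two_mul] at e
    norm_num at e
    simp only [qJ_eq]
    push_cast
    rw [← e]
    refine hasSum_nahmTerm hh2 m4 fun i j k => ?_
    rw [qpow_eq, nome_mul]
    ring_nf
  · rw [← ternSum_neg_self_eq_qJbar]
    refine hasSum_nahmTerm hh2 m4 fun i j k => ?_
    rw [qpow_eq, nome_mul]
    ring_nf
  · have e := ternSum_zero_zero_neg_one hh
    simp only [qJ_eq]
    push_cast
    rw [← e]
    refine hasSum_nahmTerm hh m2 fun i j k => ?_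
    rw [qpow_eq]
    ring_nf
  · have e := ternSum_one_one_neg_one hh
    simp only [qJ_eq]
    push_cast
    rw [← e]
    refine hasSum_nahmTerm hh m2 fun i j k => ?_
    rw [qpow_eq]
    ring_nf
  · have e := ternSum_one_one_zero hh
    simp only [qJ_eq]
    push_cast
    rw [← e]
    refine hasSum_nahmTerm hh m2 fun i j k => ?_
    rw [qpow_eq]
    ring_nf
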